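/- \textbf{Notation.} Let $p,q\in\mathbb C$ with $|p|<1$, $q\neq 0$, and put $$\theta(x;p)=\prod_{j=0}^\infty(1-p^jx)(1-p^{j+1}/x),\qquad \theta(x_1,\dots,x_n;p)=\prod_{i=1}^n\theta(x_i;p),$$ $$(x;q,p)_k=\prod_{j=0}^{k-1}\theta(xq^j;p),\qquad (x_1,\dots,x_n;q,p)_k=\prod_{i=1}^n(x_i;q,p)_k,$$ $$h_k(x;a)=h_k(x;a;q,p)=(a\xi,a\xi^{-1};q,p)_k,\qquad \xi+\xi^{-1}=x,$$ $${}_{12}V_{11}(a;b,c,d,e,f,g,q^{-n};q,p)=\sum_{j=0}^n\frac{\theta(aq^{2j};p)}{\theta(a;p)}\,\frac{(a,b,c,d,e,f,g,q^{-n};q,p)_j}{(q,aq/b,aq/c,aq/d,aq/e,aq/f,aq/g,aq^{n+1};q,p)_j}\,q^j,$$ where the parameters of ${}_{12}V_{11}$ satisfy the balancing condition $a^3q^{n+2}=bcdefg$, and where terms of the sum with vanishing numerator are taken to be $0$. \textbf{Theorem (elliptic $6j$-symbols).} Let $N\ge 0$ be an integer and let $a,b,c,d$ be non-zero complex numbers.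 Assume that the parameters are generic in the following sense: for all $m\in\mathbb Z$ (with $0^0=1$ and $0^m$ read as $0$ for all $m\neq 0$ if $p=0$), $$p^mq^i\neq 1\quad(1\le i\le N),\qquad c/d\neq p^mq^i\quad(1-N\le i\le N-1),\qquad b/c\neq p^mq^i\quad(-N\le i\le N),$$ $$cd,\ bc,\ ac,\ bd,\ a/c,\ b/d\ \neq\ p^mq^i\quad(1-N\le i\le 0).$$ Then, for each $k$ with $0\le k\le N$, there are unique complex numbers $R_k^l=R_k^l(a,b,c,d;N;q,p)$, $0\le l\le N$, such that $$h_k(x;a)\,h_{N-k}(x;b)=\sum_{l=0}^N R_k^l(a,b,c,d;N;q,p)\,h_l(x;c)\,h_{N-l}(x;d)\qquad\text{for all }x\in\mathbb C,$$ and they are given by $$\begin{aligned}R_k^l(a,b,c,d;N;q,p)={}&q^{l(l-N)}\frac{(q;q,p)_N}{(q;q,p)_l(q;q,p)_{N-l}}\\ &\times\frac{(ac,a/c;q,p)_k\,(q^{N-l}bd,b/d;q,p)_l\,(b/c;q,p)_{N-k}\,(b/c;q,p)_{N-l}\,(bc;q,p)_{N-k}}{(q^{l-N}c/d;q,p)_l\,(q^{-l}d/c;q,p)_{N-l}\,(cd;q,p)_N\,(b/c;q,p)_N\,(bc;q,p)_l}\\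 &\times{}_{12}V_{11}\bigl(q^{-N}c/b;\,q^{-k},q^{-l},q^{k-N}a/b,q^{l-N}c/d,cd,q^{1-N}/ab,qc/b;\,q,p\bigr),\end{aligned}$$ where the ${}_{12}V_{11}$ series is balanced and is terminated by the parameter $q^{-k}$, that is, $n=k$ (the terms with $j>l$ vanish because of $q^{-l}$). -/

import Mathlib

noncomputable section

namespace EllipticSixJ

/-- The theta function `θ(x;p) = ∏_{j ≥ 0} (1 - p^j x)(1 - p^{j+1}/x)`. -/
def theta (x p : ℂ) : ℂ :=
  ∏' j : ℕ, (1 - p ^ j * x) * (1 - p ^ (j + 1) / x)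

/-- The product defining `theta` converges for `|p| < 1`. -/
theorem multipliable_theta (x p : ℂ) (hp : ‖p‖ < 1) :
    Multipliable fun j : ℕ => (1 - p ^ j * x) * (1 - p ^ (j + 1) / x) := by
  have hs : Summable fun j : ℕ => ‖p‖ ^ j :=
    summable_geometric_of_lt_one (norm_nonneg p) hp
  have h1 : Multipliable fun j : ℕ => (1 + -(p ^ j * x)) := by
    apply multipliable_one_add_of_summable
    simpa [norm_neg, norm_mul, norm_pow] using hs.mul_right ‖x‖
  have h2 : Multipliable fun j : ℕ => (1 + -(p ^ (j + 1) / x)) := by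
    apply multipliable_one_add_of_summable
    have := hs.mul_right (‖p‖ / ‖x‖)
    refine this.congr fun j => ?_
    simp only [norm_neg, norm_div, norm_pow]
    ring
  simpa [sub_eq_add_neg] using h1.mul h2

/-- The elliptic shifted factorial `(x;q,p)_k = ∏_{j=0}^{k-1} θ(x q^j; p)`. -/
def poch (q p x : ℂ) (k : ℕ) : ℂ :=
  ∏ j ∈ Finset.range k, theta (x * q ^ j) p

theorem exists_xi (x : ℂ) : ∃ ξ : ℂ, ξ ≠ 0 ∧ ξ + ξ⁻¹ = x := by
  obtain ⟨s, hs⟩ := IsAlgClosed.exists_eq_mul_self (x ^ 2 - 4)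
  have h0 : (x + s) / 2 ≠ 0 := by
    intro h
    have h1 : x + s = 0 := by simpa using h
    have h2 : s = -x := by linear_combination h1
    rw [h2] at hs
    have : (4 : ℂ) = 0 := by linear_combination -hs
    norm_num at this
  refine ⟨(x + s) / 2, h0, ?_⟩
  apply mul_left_cancel₀ h0
  rw [mul_add, mul_inv_cancel₀ h0]
  linear_combination (-1 / 4 : ℂ) * hs

/-- `h_k(x;a;q,p) = (aξ, a/ξ; q,p)_k`, where `ξ + 1/ξ = x`; the value does not depend on
which of the two solutions `ξ` is taken, see `h_add_inv`. -/
def h (q p : ℂ) (k : ℕ) (x a : ℂ) : ℂ :=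
  poch q p (a * (exists_xi x).choose) k * poch q p (a * (exists_xi x).choose⁻¹) k

theorem h_add_inv (q p : ℂ) (k : ℕ) (a ξ : ℂ) (hξ : ξ ≠ 0) :
    h q p k (ξ + ξ⁻¹) a = poch q p (a * ξ) k * poch q p (a * ξ⁻¹) k := by
  obtain ⟨h0, h1⟩ := (exists_xi (ξ + ξ⁻¹)).choose_spec
  unfold h
  generalize (exists_xi (ξ + ξ⁻¹)).choose = η at h0 h1
  have h2 : (η - ξ) * (η * ξ - 1) = 0 := by
    field_simp at h1
    linear_combination h1
  rcases mul_eq_zero.mp h2 with h3 | h3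
  · rw [sub_eq_zero.mp h3]
  · have h4 : η = ξ⁻¹ := by
      apply eq_inv_of_mul_eq_one_left
      linear_combination h3
    rw [h4, inv_inv, mul_comm]

/-- The terminating very-well-poised elliptic hypergeometric series
`₁₂V₁₁(a; b, c, d, e, f, g, q^{-n}; q, p)`. -/
def V12 (q p : ℂ) (n : ℕ) (a b c d e f g : ℂ) : ℂ :=
  ∑ k ∈ Finset.range (n + 1),
    theta (a * q ^ (2 * k)) p / theta a p *
      ((poch q p a k * poch q p b k * poch q p c k * poch q p d k * poch q p e k *
          poch q p f k * poch q p g k * poch q p (q ^ (-(n : ℤ))) k) /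
        (poch q p q k * poch q p (a * q / b) k * poch q p (a * q / c) k *
          poch q p (a * q / d) k * poch q p (a * q / e) k * poch q p (a * q / f) k *
          poch q p (a * q / g) k * poch q p (a * q ^ (n + 1)) k)) *
      q ^ k

/-- The balancing condition for `₁₂V₁₁(a; b, c, d, e, f, g, q^{-n}; q, p)`. -/
def IsBalanced (q : ℂ) (n : ℕ) (a b c d e f g : ℂ) : Prop :=
  a ^ 3 * q ^ (n + 2) = b * c * d * e * f * g

/-- The factor in front of the series in the expression for `R_k^l(a,b,c,d;N;q,p)`. -/
def prefactor (q p a b c d : ℂ) (N k l : ℕ) : ℂ :=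
  q ^ ((l : ℤ) * ((l : ℤ) - N)) * (poch q p q N / (poch q p q l * poch q p q (N - l))) *
    ((poch q p (a * c) k * poch q p (a / c) k *
        (poch q p (q ^ (N - l) * b * d) l * poch q p (b / d) l) *
        poch q p (b / c) (N - k) * poch q p (b / c) (N - l) * poch q p (b * c) (N - k)) /
      (poch q p (q ^ ((l : ℤ) - N) * c / d) l * poch q p (q ^ (-(l : ℤ)) * d / c) (N - l) *
        poch q p (c * d) N * poch q p (b / c) N * poch q p (b * c) l))

/-- `x ≠ p^m q^i` for all integers `m` and all integers `i` with `r ≤ i ≤ s`. -/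
def Avoids (q p x : ℂ) (r s : ℤ) : Prop :=
  ∀ m i : ℤ, r ≤ i → i ≤ s → x ≠ p ^ m * q ^ i

/-- Generic parameters: `|p| < 1`, the other parameters are non-zero, and no theta function
vanishes in the denominators of the prefactors and of the (non-zero terms of the) series. -/
structure Generic (q p a b c d : ℂ) (N : ℕ) : Prop where
  p_lt : ‖p‖ < 1
  q_ne : q ≠ 0
  a_ne : a ≠ 0
  b_ne : b ≠ 0
  c_ne : c ≠ 0
  d_ne : d ≠ 0
  q_pow : Avoids q p 1 1 N
  c_div_d : Avoids q p (c / d) (1 - N) (N - 1)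
  c_mul_d : Avoids q p (c * d) (1 - N) 0
  b_div_c : Avoids q p (b / c) (-N) N
  b_mul_c : Avoids q p (b * c) (1 - N) 0
  a_div_c : Avoids q p (a / c) (1 - N) 0
  a_mul_c : Avoids q p (a * c) (1 - N) 0
  b_div_d : Avoids q p (b / d) (1 - N) 0
  b_mul_d : Avoids q p (b * d) (1 - N) 0

/-- The numbers `R l`, `0 ≤ l ≤ N`, are coefficients in the expansion
`h_k(x;a) h_{N-k}(x;b) = ∑_{l=0}^N R_l h_l(x;c) h_{N-l}(x;d)`, identically in `x`. -/
def IsExpansion (q p a b c d : ℂ) (N k : ℕ) (R : Fin (N + 1) → ℂ) : Prop :=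
  ∀ x : ℂ, h q p k x a * h q p (N - k) x b =
    ∑ l : Fin (N + 1), R l * (h q p l x c * h q p (N - l) x d)

end EllipticSixJ

end

noncomputable section

namespace EllipticSixJ

open Filter Topology

/-! The coefficients come from applying the elliptic binomial theorem (`hXi_eq_sum_antidiagonal`)
twice. Expand `h_k(x;a)` in the products `h_j(x;c) h_{k-j}(x;bq^{N-k})`. The second factor merges
with `h_{N-k}(x;b)` into `h_{N-j}(x;b)`, which is expanded in `h_i(x;cq^j) h_{N-j-i}(x;d)`. Finally
`h_j(x;c) h_i(x;cq^j) = h_{i+j}(x;c)`. Hence `R_k^l` is a single sum over `j` of products of two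
explicit binomial coefficients. By `binomCoeff_mul_eq` these products are the terms of the `₁₂V₁₁`
times the prefactor: they agree at `j = 0`, and consecutive ratios agree by `ratio_identity`.

The binomial theorem is an induction through a Pascal rule, whose only analytic input is the
addition formula `theta_addition`. That formula is the Plücker relation for two-by-two minors, since
`θ(xy)θ(x/y) = x(F(x)G(y) - G(x)F(y))`. The functions `F` and `G` are found by multiplying two theta
series and separating variables according to parity. The series itself is Jacobi's triple product,
needed only up to a non-zero constant.

Uniqueness (`eq_zero_of_sum_hXi_eq_zero`) is an induction: `ξ = c` kills every product with `l ≥ 1`,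
which gives `R_0 = 0`. The common factor `h_1(x;c)` is then divided out, which replaces `c` by `cq`.
-/

/-! ### Jacobi's triple product, up to a constant -/

/-- The `k`-th triangular number `k(k-1)/2`, for integral `k`. -/
def tri (k : ℤ) : ℤ := k * (k - 1) / 2

theorem two_mul_tri (k : ℤ) : 2 * tri k = k * (k - 1) := by
  unfold tri
  exact Int.mul_ediv_cancel' (by simpa [mul_comm] using (Int.even_mul_pred_self k).two_dvd)

theorem tri_add_one (k : ℤ) : tri (k + 1) = tri k + k := by
  have h1 := two_mul_tri k
  have h2 := two_mul_tri (k + 1)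
  have : 2 * tri (k + 1) = 2 * (tri k + k) := by rw [h2, mul_add, h1]; ring
  linarith

/-- The Gaussian binomial coefficient. -/
def gaussBinom (p : ℂ) : ℕ → ℕ → ℂ
  | _, 0 => 1
  | 0, _ + 1 => 0
  | m + 1, k + 1 => p ^ (k + 1) * gaussBinom p m (k + 1) + gaussBinom p m k

theorem gaussBinom_zero_right (p : ℂ) (m : ℕ) : gaussBinom p m 0 = 1 := by
  cases m <;> rfl

theorem gaussBinom_eq_zero (p : ℂ) {m k : ℕ} (hk : m < k) : gaussBinom p m k = 0 := by
  induction m generalizing k with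
  | zero => obtain ⟨k, rfl⟩ := Nat.exists_eq_add_of_lt hk; rfl
  | succ m ih =>
    obtain ⟨k, rfl⟩ := Nat.exists_eq_add_of_lt hk
    rw [show m + 1 + k + 1 = (m + 1 + k) + 1 by ring, gaussBinom, ih (by omega), ih (by omega)]
    simp

theorem gaussBinom_self (p : ℂ) (m : ℕ) : gaussBinom p m m = 1 := by
  induction m with
  | zero => rfl
  | succ m ih => rw [gaussBinom, ih, gaussBinom_eq_zero p (Nat.lt_succ_self m)]; simp

/-- The product `∏_{1 ≤ j ≤ n} (1 - p^j)`. -/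
def qFactorial (p : ℂ) (n : ℕ) : ℂ := ∏ j ∈ Finset.range n, (1 - p ^ (j + 1))

theorem gaussBinom_mul (p : ℂ) (i j : ℕ) :
    gaussBinom p (i + j) i * (qFactorial p i * qFactorial p j) = qFactorial p (i + j) := by
  induction hn : i + j generalizing i j with
  | zero =>
    obtain ⟨rfl, rfl⟩ : i = 0 ∧ j = 0 := by omega
    simp [gaussBinom, qFactorial]
  | succ n ih =>
    rcases i with _ | i
    · obtain rfl : j = n + 1 := by omega
      simp [gaussBinom, qFactorial]
    rcases j with _ | j
    · obtain rfl : i = n := by omega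
      rw [gaussBinom_self]; simp [qFactorial]
    have h1 := ih (i + 1) j (by omega)
    have h2 := ih i (j + 1) (by omega)
    obtain rfl : n = i + 1 + j := by omega
    rw [gaussBinom]
    have hs : ∀ m, qFactorial p (m + 1) = qFactorial p m * (1 - p ^ (m + 1)) := fun m => by
      simp [qFactorial, Finset.prod_range_succ]
    rw [hs (i + 1 + j)]
    rw [hs j] at h2 ⊢
    rw [hs i] at h1 ⊢
    linear_combination (p ^ (i + 1) * (1 - p ^ (j + 1))) * h1 + (1 - p ^ (i + 1)) * h2

/-- Rothe's identity. -/
theorem prod_one_sub_pow_mul {p : ℂ} (hp : p ≠ 0) (m : ℕ) (t : ℂ) :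
    ∏ j ∈ Finset.range m, (1 - p ^ j * t) =
      ∑ k ∈ Finset.range (m + 1), gaussBinom p m k * (p ^ tri k * (-t) ^ k) := by
  induction m generalizing t with
  | zero => simp [gaussBinom, tri]
  | succ m ih =>
    have h1 : ∏ j ∈ Finset.range (m + 1), (1 - p ^ j * t) =
        (∏ j ∈ Finset.range m, (1 - p ^ j * (p * t))) * (1 - t) := by
      rw [Finset.prod_range_succ']
      simp only [pow_zero, one_mul, pow_succ, mul_assoc]
    have h2 : ∀ k : ℕ, p ^ tri ((k + 1 : ℕ) : ℤ) = p ^ tri k * p ^ k := fun k => by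
      rw [Nat.cast_succ, tri_add_one, zpow_add₀ hp, zpow_natCast]
    rw [h1, ih, Finset.sum_range_succ' _ (m + 1), mul_sub, mul_one]
    have h3 : ∑ k ∈ Finset.range (m + 1), gaussBinom p m k * (p ^ tri k * (-(p * t)) ^ k) =
        (∑ k ∈ Finset.range (m + 1), gaussBinom p m (k + 1) *
          (p ^ tri ((k + 1 : ℕ) : ℤ) * (-(p * t)) ^ (k + 1))) + 1 := by
      rw [Finset.sum_range_succ' _ m, Finset.sum_range_succ _ m,
        gaussBinom_eq_zero p (Nat.lt_succ_self m)]
      simp [gaussBinom_zero_right, tri]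
    nth_rewrite 1 [h3]
    rw [gaussBinom_zero_right, Finset.sum_mul]
    simp only [CharP.cast_eq_zero, tri, zero_mul, EuclideanDomain.zero_div, zpow_zero, pow_zero,
      mul_one]
    rw [add_sub_right_comm, ← Finset.sum_sub_distrib]
    congr 1
    refine Finset.sum_congr rfl fun k _ => ?_
    have h4 := h2 k
    unfold tri at h4
    rw [gaussBinom, h4, neg_mul_eq_mul_neg, mul_pow, mul_pow]
    ring

/-- The terms of the theta series. -/
def thetaTerm (p x : ℂ) (k : ℤ) : ℂ := p ^ tri k * (-x) ^ k

theorem thetaTerm_add_one {p x : ℂ} (hp : p ≠ 0) (hx : x ≠ 0) (k : ℤ) :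
    thetaTerm p x (k + 1) = thetaTerm p x k * (p ^ k * (-x)) := by
  unfold thetaTerm
  rw [tri_add_one, zpow_add₀ hp, zpow_add₀ (neg_ne_zero.mpr hx), zpow_one]
  ring

/-- The ratio `p^n c` tends to zero, so the ratio test applies; both tails of the theta series have
this shape. -/
theorem summable_of_geometric_ratio {f : ℕ → ℂ} {p c : ℂ} (hp : ‖p‖ < 1)
    (hf : ∀ n, f (n + 1) = f n * (p ^ n * c)) : Summable fun n => ‖f n‖ := by
  have h1 : Tendsto (fun n : ℕ => ‖p ^ n * c‖) atTop (𝓝 0) := by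
    have := ((tendsto_pow_atTop_nhds_zero_of_norm_lt_one hp).mul_const c).norm
    simpa using this
  refine summable_of_ratio_norm_eventually_le (r := 1 / 2) (by norm_num) ?_
  filter_upwards [h1.eventually (gt_mem_nhds (show (0 : ℝ) < 1 / 2 by norm_num))] with n hn
  rw [norm_norm, norm_norm, hf, norm_mul, mul_comm]
  exact mul_le_mul_of_nonneg_right hn.le (norm_nonneg _)

theorem summable_thetaTerm {p x : ℂ} (hp : ‖p‖ < 1) (hp0 : p ≠ 0) (hx : x ≠ 0) :
    Summable fun k => ‖thetaTerm p x k‖ := by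
  refine Summable.of_nat_of_neg_add_one ?_ ?_
  · refine summable_of_geometric_ratio (c := -x) hp fun n => ?_
    rw [Nat.cast_succ, thetaTerm_add_one hp0 hx, zpow_natCast]
  · refine summable_of_geometric_ratio (p := p) (c := p ^ 2 * (-x)⁻¹) hp fun n => ?_
    have := thetaTerm_add_one hp0 hx (-((n + 1 : ℕ) + 1 : ℤ))
    rw [show (-((n + 1 : ℕ) + 1 : ℤ) + 1) = -((n : ℤ) + 1) by push_cast; ring] at this
    rw [this, show (-((n + 1 : ℕ) + 1 : ℤ)) = -((n + 2 : ℕ) : ℤ) by push_cast; ring, zpow_neg,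
      zpow_natCast]
    have : -x ≠ 0 := neg_ne_zero.mpr hx
    field_simp
    ring

/-- The shifted Gaussian binomial coefficients which occur in the finite form of the triple
product identity. -/
def tripleCoeff (p : ℂ) (n : ℕ) (k : ℤ) : ℂ :=
  if 0 ≤ (n : ℤ) + k then gaussBinom p (2 * n) ((n : ℤ) + k).toNat else 0

/-- This is Rothe's identity with `2n` factors at `t = p^{-n} x`, recentred by `k ↦ k - n`. The
first `n` factors, read backwards, become `1 - p^{j+1}/x` at the cost of the monomials `-x
p^{-(j+1)}`. -/
theorem finite_triple_product {p x : ℂ} (hp : p ≠ 0) (hx : x ≠ 0) (n : ℕ) :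
    ∏ j ∈ Finset.range n, ((1 - p ^ j * x) * (1 - p ^ (j + 1) / x)) =
      ∑' k : ℤ, tripleCoeff p n k * thetaTerm p x k := by
  have hinj : Function.Injective fun k : ℕ => (k : ℤ) - n := fun a b h => by simpa using h
  have hsupp : Function.support (fun k : ℤ => tripleCoeff p n k * thetaTerm p x k) ⊆
      Set.range fun k : ℕ => (k : ℤ) - n := by
    intro k hk
    have : 0 ≤ (n : ℤ) + k := by
      by_contra h
      exact hk (by simp [tripleCoeff, h])
    exact ⟨((n : ℤ) + k).toNat, by simp [Int.toNat_of_nonneg this]⟩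
  rw [← hinj.tsum_eq hsupp, tsum_eq_sum (s := Finset.range (2 * n + 1))]
  swap
  · intro k hk
    rw [Finset.mem_range, not_lt] at hk
    simp [tripleCoeff, gaussBinom_eq_zero p (show 2 * n < k by omega)]
  have hx' : -x ≠ 0 := neg_ne_zero.mpr hx
  have h1 : ∏ j ∈ Finset.range n, (-x * (p ^ (j + 1))⁻¹) = (-x) ^ n * (p ^ tri (n + 1))⁻¹ := by
    clear hinj hsupp
    induction n with
    | zero => simp [tri]
    | succ n ih =>
      rw [Finset.prod_range_succ, ih, Nat.cast_succ, tri_add_one (n + 1), zpow_add₀ hp, pow_succ,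
        mul_inv, show ((n : ℤ) + 1) = ((n + 1 : ℕ) : ℤ) by push_cast; ring, zpow_natCast]
      ring
  have h2 : ∏ j ∈ Finset.range (2 * n), (1 - p ^ j * ((p ^ n)⁻¹ * x)) =
      ((-x) ^ n * (p ^ tri (n + 1))⁻¹) *
        ∏ j ∈ Finset.range n, ((1 - p ^ j * x) * (1 - p ^ (j + 1) / x)) := by
    rw [two_mul, Finset.prod_range_add, ← h1, ← Finset.prod_range_reflect,
      ← Finset.prod_mul_distrib, ← Finset.prod_mul_distrib]
    refine Finset.prod_congr rfl fun j hj => ?_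
    rw [Finset.mem_range] at hj
    obtain ⟨i, rfl⟩ := Nat.exists_eq_add_of_lt hj
    rw [show j + i + 1 - 1 - j = i by omega]
    rw [show j + i + 1 = i + (j + 1) by ring, pow_add p i (j + 1), pow_add p (i + (j + 1)) j,
      pow_add p i (j + 1)]
    field_simp
    ring
  have h3 : (-x) ^ n * (p ^ tri (n + 1))⁻¹ ≠ 0 :=
    mul_ne_zero (pow_ne_zero _ hx') (inv_ne_zero (zpow_ne_zero _ hp))
  apply mul_left_cancel₀ h3
  rw [← h2, prod_one_sub_pow_mul hp, Finset.mul_sum]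
  refine Finset.sum_congr rfl fun k _ => ?_
  have h4 : (n : ℤ) + ((k : ℤ) - n) = k := by ring
  rw [tripleCoeff, h4, if_pos (Int.natCast_nonneg k), Int.toNat_natCast, thetaTerm,
    mul_left_comm ((-x) ^ n * _)]
  congr 1
  have h5 : tri ((k : ℤ) - n) = tri (n + 1) + tri k - n * k := by
    have e1 := two_mul_tri ((k : ℤ) - n)
    have e2 := two_mul_tri ((n : ℤ) + 1)
    have e3 := two_mul_tri (k : ℤ)
    have : 2 * tri ((k : ℤ) - n) = 2 * (tri (n + 1) + tri k - n * k) := by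
      rw [mul_sub, mul_add, e1, e2, e3]; ring
    linarith
  rw [h5, zpow_sub₀ hp, zpow_add₀ hp, zpow_sub₀ hx', zpow_natCast, zpow_natCast, zpow_mul,
    zpow_natCast, zpow_natCast, neg_mul_eq_mul_neg, mul_pow, inv_pow]
  have := zpow_ne_zero (tri (n + 1)) hp
  field_simp

theorem exists_tendsto_qFactorial {p : ℂ} (hp : ‖p‖ < 1) :
    ∃ K : ℂ, K ≠ 0 ∧ Tendsto (qFactorial p) atTop (𝓝 K) := by
  have hs : Summable fun j : ℕ => ‖-p ^ (j + 1)‖ := by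
    simpa using (summable_nat_add_iff 1).mpr (summable_geometric_of_lt_one (norm_nonneg p) hp)
  refine ⟨∏' j : ℕ, (1 + -p ^ (j + 1)), tprod_one_add_ne_zero_of_summable (fun j h => ?_) hs, ?_⟩
  · have h1 : p ^ (j + 1) = 1 := by linear_combination -h
    have h2 := pow_lt_one₀ (norm_nonneg p) hp (Nat.succ_ne_zero j)
    rw [← norm_pow, h1, norm_one] at h2
    exact lt_irrefl _ h2
  · have := (multipliable_one_add_of_summable hs).hasProd.tendsto_prod_nat
    exact this.congr fun n => Finset.prod_congr rfl fun j _ => (sub_eq_add_neg _ _).symm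

theorem qFactorial_ne_zero {p : ℂ} (hp : ‖p‖ < 1) (n : ℕ) : qFactorial p n ≠ 0 := by
  refine Finset.prod_ne_zero_iff.mpr fun j _ h => ?_
  have h1 : p ^ (j + 1) = 1 := by linear_combination -h
  have h2 := pow_lt_one₀ (norm_nonneg p) hp (Nat.succ_ne_zero j)
  rw [← norm_pow, h1, norm_one] at h2
  exact lt_irrefl _ h2

/-- In this symmetric form both the limit as `n → ∞` and a bound uniform in `n` and `k` follow from
the convergence of `qFactorial` to a non-zero limit. -/
theorem tripleCoeff_of_le {p : ℂ} (hp : ‖p‖ < 1) {n : ℕ} {k : ℤ} (h1 : 0 ≤ (n : ℤ) + k)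
    (h2 : 0 ≤ (n : ℤ) - k) :
    tripleCoeff p n k = qFactorial p (2 * n) *
      ((qFactorial p ((n : ℤ) + k).toNat)⁻¹ * (qFactorial p ((n : ℤ) - k).toNat)⁻¹) := by
  have h3 : 2 * n = ((n : ℤ) + k).toNat + ((n : ℤ) - k).toNat := by omega
  have h4 := qFactorial_ne_zero hp ((n : ℤ) + k).toNat
  have h5 := qFactorial_ne_zero hp ((n : ℤ) - k).toNat
  rw [tripleCoeff, if_pos h1, h3, ← gaussBinom_mul p]
  field_simp

theorem tripleCoeff_eq_zero (p : ℂ) {n : ℕ} {k : ℤ} (h : (n : ℤ) + k < 0 ∨ (n : ℤ) - k < 0) :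
    tripleCoeff p n k = 0 := by
  unfold tripleCoeff
  split_ifs with h1
  · exact gaussBinom_eq_zero p (by omega)
  · rfl

/-- Jacobi's triple product identity, up to the constant factor. -/
theorem exists_theta_eq_tsum {p : ℂ} (hp : ‖p‖ < 1) (hp0 : p ≠ 0) :
    ∃ K : ℂ, K ≠ 0 ∧ ∀ x : ℂ, x ≠ 0 → theta x p = K * ∑' k : ℤ, thetaTerm p x k := by
  obtain ⟨K, hK, hlim⟩ := exists_tendsto_qFactorial hp
  refine ⟨K⁻¹, inv_ne_zero hK, fun x hx => ?_⟩
  have hinv : Tendsto (fun n => (qFactorial p n)⁻¹) atTop (𝓝 K⁻¹) := hlim.inv₀ hK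
  obtain ⟨A, hA⟩ := hlim.norm.bddAbove_range
  obtain ⟨B, hB⟩ := hinv.norm.bddAbove_range
  replace hA : ∀ n, ‖qFactorial p n‖ ≤ A := fun n => hA ⟨n, rfl⟩
  replace hB : ∀ n, ‖(qFactorial p n)⁻¹‖ ≤ B := fun n => hB ⟨n, rfl⟩
  have hA0 : 0 ≤ A := (norm_nonneg _).trans (hA 0)
  have hB0 : 0 ≤ B := (norm_nonneg _).trans (hB 0)
  have hc : ∀ k : ℤ, Tendsto (fun n => tripleCoeff p n k) atTop (𝓝 K⁻¹) := by
    intro k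
    have e1 : Tendsto (fun n : ℕ => ((n : ℤ) + k).toNat) atTop atTop :=
      tendsto_atTop.mpr fun b => eventually_atTop.mpr ⟨b + k.natAbs, fun n hn => by omega⟩
    have e2 : Tendsto (fun n : ℕ => ((n : ℤ) - k).toNat) atTop atTop :=
      tendsto_atTop.mpr fun b => eventually_atTop.mpr ⟨b + k.natAbs, fun n hn => by omega⟩
    have e3 : Tendsto (fun n : ℕ => 2 * n) atTop atTop :=
      tendsto_atTop.mpr fun b => eventually_atTop.mpr ⟨b, fun n hn => by omega⟩
    have := (hlim.comp e3).mul ((hinv.comp e1).mul (hinv.comp e2))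
    rw [mul_inv_cancel_left₀ hK] at this
    refine this.congr' (eventually_atTop.mpr ⟨k.natAbs, fun n hn => ?_⟩)
    exact (tripleCoeff_of_le hp (by omega) (by omega)).symm
  have hbound : ∀ n k, ‖tripleCoeff p n k‖ ≤ A * (B * B) := by
    intro n k
    by_cases h : 0 ≤ (n : ℤ) + k ∧ 0 ≤ (n : ℤ) - k
    · rw [tripleCoeff_of_le hp h.1 h.2, norm_mul, norm_mul]
      gcongr
      exacts [hA _, hB _, hB _]
    · rw [tripleCoeff_eq_zero p (by omega), norm_zero]
      positivity
  -- Dominated convergence: the coefficients are uniformly bounded and the theta series converges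
  -- absolutely.
  have h1 : Tendsto (fun n => ∑' k : ℤ, tripleCoeff p n k * thetaTerm p x k) atTop
      (𝓝 (∑' k : ℤ, K⁻¹ * thetaTerm p x k)) := by
    refine tendsto_tsum_of_dominated_convergence
      ((summable_thetaTerm hp hp0 hx).mul_left (A * (B * B)))
      (fun k => (hc k).mul_const _) (Eventually.of_forall fun n k => ?_)
    rw [norm_mul]
    exact mul_le_mul_of_nonneg_right (hbound n k) (norm_nonneg _)
  have h2 := (multipliable_theta x p hp).hasProd.tendsto_prod_nat
  rw [← tsum_mul_left]
  refine tendsto_nhds_unique h2 (h1.congr fun n => ?_)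
  rw [finite_triple_product hp0 hx]

/-! ### Products of two theta functions and the addition formula -/

/-- The substitution of sum and difference diagonalises the quadratic exponent, so the product
separates into a function of `x` and `s` times a function of `y` and `t`. The next lemma is the case
of odd index sum. -/
theorem thetaTerm_mul_even {p x y : ℂ} (hp : p ≠ 0) (hx : x ≠ 0) (hy : y ≠ 0) (s t : ℤ) :
    thetaTerm p (x * y) (s + t) * thetaTerm p (x / y) (s - t) =
      p ^ (s * (s - 1)) * x ^ (2 * s) * (p ^ (t * t) * y ^ (2 * t)) := by
  have h1 : tri (s + t) + tri (s - t) = s * (s - 1) + t * t := by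
    linarith [two_mul_tri (s + t), two_mul_tri (s - t)]
  have h2 : p ^ tri (s + t) * p ^ tri (s - t) = p ^ (s * (s - 1)) * p ^ (t * t) := by
    rw [← zpow_add₀ hp, h1, zpow_add₀ hp]
  have h3 : (-x) ^ (s + t) * (-x) ^ (s - t) = x ^ (2 * s) := by
    rw [← zpow_add₀ (neg_ne_zero.mpr hx), show s + t + (s - t) = 2 * s by ring,
      (even_two_mul s).neg_zpow]
  have h4 : y ^ (s + t) * (y⁻¹) ^ (s - t) = y ^ (2 * t) := by
    rw [inv_zpow', ← zpow_add₀ hy]; congr 1; ring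
  rw [thetaTerm, thetaTerm, div_eq_mul_inv, ← neg_mul, ← neg_mul, mul_zpow, mul_zpow, ← h3, ← h4]
  linear_combination ((-x) ^ (s + t) * (-x) ^ (s - t) * (y ^ (s + t) * (y⁻¹) ^ (s - t))) * h2

theorem thetaTerm_mul_odd {p x y : ℂ} (hp : p ≠ 0) (hx : x ≠ 0) (hy : y ≠ 0) (s t : ℤ) :
    thetaTerm p (x * y) (s + t + 1) * thetaTerm p (x / y) (s - t) =
      -(p ^ (s * s) * x ^ (2 * s + 1)) * (p ^ (t * (t + 1)) * y ^ (2 * t + 1)) := by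
  have h1 : tri (s + t + 1) + tri (s - t) = s * s + t * (t + 1) := by
    linarith [two_mul_tri (s + t + 1), two_mul_tri (s - t)]
  have h2 : p ^ tri (s + t + 1) * p ^ tri (s - t) = p ^ (s * s) * p ^ (t * (t + 1)) := by
    rw [← zpow_add₀ hp, h1, zpow_add₀ hp]
  have h3 : (-x) ^ (s + t + 1) * (-x) ^ (s - t) = -x ^ (2 * s + 1) := by
    rw [← zpow_add₀ (neg_ne_zero.mpr hx), show s + t + 1 + (s - t) = 2 * s + 1 by ring,
      (odd_two_mul_add_one s).neg_zpow]
  have h4 : y ^ (s + t + 1) * (y⁻¹) ^ (s - t) = y ^ (2 * t + 1) := by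
    rw [inv_zpow', ← zpow_add₀ hy]; congr 1; ring
  rw [thetaTerm, thetaTerm, div_eq_mul_inv, ← neg_mul, ← neg_mul, mul_zpow, mul_zpow, ← h4]
  linear_combination
    ((-x) ^ (s + t + 1) * (-x) ^ (s - t) * (y ^ (s + t + 1) * (y⁻¹) ^ (s - t))) * h2 +
    p ^ (s * s) * p ^ (t * (t + 1)) * (y ^ (s + t + 1) * (y⁻¹) ^ (s - t)) * h3

/-- The two maps `(s,t) ↦ (s+t, s-t)` and `(s+t+1, s-t)` parametrise the pairs with even and with
odd coordinate sum. -/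
theorem tsum_int_prod_eq_add {f : ℤ × ℤ → ℂ} (hf : Summable f) :
    ∑' z, f z = (∑' s : ℤ, ∑' t : ℤ, f (s + t, s - t)) +
      ∑' s : ℤ, ∑' t : ℤ, f (s + t + 1, s - t) := by
  let e₀ : ℤ × ℤ → ℤ × ℤ := fun z => (z.1 + z.2, z.1 - z.2)
  let e₁ : ℤ × ℤ → ℤ × ℤ := fun z => (z.1 + z.2 + 1, z.1 - z.2)
  have h₀ : Function.Injective e₀ := fun z w h => by
    simp only [e₀, Prod.mk.injEq] at h
    ext <;> omega
  have h₁ : Function.Injective e₁ := fun z w h => by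
    simp only [e₁, Prod.mk.injEq] at h
    ext <;> omega
  have hc : (Set.range e₀)ᶜ = Set.range e₁ := by
    ext ⟨m, n⟩
    simp only [Set.mem_compl_iff, Set.mem_range, Prod.exists, Prod.mk.injEq, e₀, e₁]
    constructor
    · intro h
      refine ⟨(m + n - 1) / 2, (m - n - 1) / 2, ?_⟩
      by_contra h1
      exact h ⟨(m + n) / 2, (m - n) / 2, by omega⟩
    · rintro ⟨s, t, h1, h2⟩ ⟨s', t', h3, h4⟩
      omega
  have h := Summable.tsum_add_tsum_compl (f := f) (s := Set.range e₀) (hf.subtype _) (hf.subtype _)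
  rw [← h, hc, tsum_range f h₀, tsum_range f h₁]
  exact congrArg₂ (· + ·) (hf.comp_injective h₀).tsum_prod (hf.comp_injective h₁).tsum_prod

/-- The products `θ(xy)θ(x/y)` are, up to the factor `x`, the minors of a matrix with two rows. -/
theorem exists_theta_mul_theta_eq {p : ℂ} (hp : ‖p‖ < 1) :
    ∃ F G : ℂ → ℂ, ∀ x y : ℂ, x ≠ 0 → y ≠ 0 →
      theta (x * y) p * theta (x / y) p = x * (F x * G y - G x * F y) := by
  -- For `p = 0` the theta function is `1 - x`, and `F(x) = x + 1/x`, `G = 1` can be written down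
  -- directly.
  rcases eq_or_ne p 0 with rfl | hp0
  · have h0 : ∀ x : ℂ, theta x 0 = 1 - x := fun x => by
      unfold theta
      rw [tprod_eq_mulSingle 0]
      · simp
      · intro j hj
        simp [hj]
    refine ⟨fun x => x + x⁻¹, fun _ => 1, fun x y hx hy => ?_⟩
    rw [h0, h0]
    field_simp
    ring
  obtain ⟨K, hK, hθ⟩ := exists_theta_eq_tsum hp hp0
  let B : ℂ → ℂ := fun y => ∑' t : ℤ, p ^ (t * t) * y ^ (2 * t)
  let C : ℂ → ℂ := fun y => ∑' t : ℤ, p ^ (t * (t + 1)) * y ^ (2 * t + 1)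
  refine ⟨fun x => K * C x, fun x => K * B x, fun x y hx hy => ?_⟩
  have hsx := summable_thetaTerm hp hp0 (mul_ne_zero hx hy)
  have hsy := summable_thetaTerm hp hp0 (div_ne_zero hx hy)
  have hs := summable_mul_of_summable_norm hsx hsy
  -- The shift `s ↦ s + 1` turns the even part's series in `x` into `x C(x)`. So the same two series
  -- `B` and `C` serve for both variables, and the even and odd parts form a determinant.
  have hA : ∑' s : ℤ, p ^ (s * (s - 1)) * x ^ (2 * s) = x * C x := by
    rw [← (Equiv.addRight (1 : ℤ)).tsum_eq, ← tsum_mul_left]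
    refine tsum_congr fun s => ?_
    rw [Equiv.coe_addRight, add_sub_cancel_right, mul_comm (s + 1),
      show 2 * (s + 1) = 2 * s + 1 + 1 by ring, zpow_add_one₀ hx (2 * s + 1)]
    ring
  have hB : ∑' s : ℤ, p ^ (s * s) * x ^ (2 * s + 1) = x * B x := by
    rw [← tsum_mul_left]
    refine tsum_congr fun s => ?_
    rw [zpow_add_one₀ hx]
    ring
  have key : (∑' k, thetaTerm p (x * y) k) * (∑' k, thetaTerm p (x / y) k) =
      x * (C x * B y - B x * C y) := by
    rw [hsx.of_norm.tsum_mul_tsum hsy.of_norm hs, tsum_int_prod_eq_add hs]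
    simp only [thetaTerm_mul_even hp0 hx hy, thetaTerm_mul_odd hp0 hx hy, tsum_mul_left,
      tsum_mul_right, tsum_neg, hA, hB]
    ring
  rw [hθ _ (mul_ne_zero hx hy), hθ _ (div_ne_zero hx hy)]
  linear_combination K ^ 2 * key

/-- The addition formula for theta functions. -/
theorem theta_addition {p : ℂ} (hp : ‖p‖ < 1) {x y z w : ℂ} (hx : x ≠ 0) (hy : y ≠ 0)
    (hz : z ≠ 0) (hw : w ≠ 0) :
    theta (x * y) p * theta (x / y) p * (theta (z * w) p * theta (z / w) p) -
      theta (x * w) p * theta (x / w) p * (theta (z * y) p * theta (z / y) p) =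
    z / y * (theta (x * z) p * theta (x / z) p) * (theta (y * w) p * theta (y / w) p) := by
  -- With all six products written as minors, the claim is the three-term Plücker relation.
  obtain ⟨F, G, h⟩ := exists_theta_mul_theta_eq hp
  rw [h x y hx hy, h z w hz hw, h x w hx hw, h z y hz hy, h x z hx hz, h y w hy hw]
  field_simp
  ring

/-! ### Inversion, zeros and continuity of theta -/

/-- The product `∏_{j ≥ 0} (1 - p^j x)`. -/
def halfTheta (p x : ℂ) : ℂ := ∏' j : ℕ, (1 + -(p ^ j * x))

theorem summable_norm_halfTheta {p : ℂ} (hp : ‖p‖ < 1) (x : ℂ) :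
    Summable fun j : ℕ => ‖-(p ^ j * x)‖ := by
  simpa [norm_neg, norm_mul, norm_pow] using
    (summable_geometric_of_lt_one (norm_nonneg p) hp).mul_right ‖x‖

theorem halfTheta_eq_mul {p : ℂ} (hp : ‖p‖ < 1) (x : ℂ) :
    halfTheta p x = (1 - x) * halfTheta p (p * x) := by
  have h := multipliable_one_add_of_summable (summable_norm_halfTheta hp (p * x))
  have e (j : ℕ) : 1 + -(p ^ j * (p * x)) = 1 + -(p ^ (j + 1) * x) := by
    rw [pow_succ, mul_assoc]
  simp only [e] at h
  have h2 : ∏' j : ℕ, (1 + -(p ^ j * x)) =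
      (1 + -(p ^ 0 * x)) * ∏' j : ℕ, (1 + -(p ^ (j + 1) * x)) := tprod_eq_zero_mul' h
  rw [halfTheta, h2, halfTheta]
  simp only [e]
  rw [pow_zero, one_mul, sub_eq_add_neg]

theorem halfTheta_ne_zero {p : ℂ} (hp : ‖p‖ < 1) {x : ℂ} (hx : ∀ j : ℕ, p ^ j * x ≠ 1) :
    halfTheta p x ≠ 0 :=
  tprod_one_add_ne_zero_of_summable (fun j h => hx j (by linear_combination -h))
    (summable_norm_halfTheta hp x)

/-- On the ball of radius `‖x‖ + 1` the factors deviate from `1` by at most `‖p‖^j (‖x‖ + 1)`, so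
the product converges locally uniformly. -/
theorem continuous_halfTheta {p : ℂ} (hp : ‖p‖ < 1) : Continuous (halfTheta p) := by
  rw [continuous_iff_continuousAt]
  intro x
  have h : HasProdLocallyUniformlyOn (fun (j : ℕ) (y : ℂ) => 1 + -(p ^ j * y))
      (fun y => ∏' j : ℕ, (1 + -(p ^ j * y))) (Metric.ball 0 (‖x‖ + 1)) := by
    refine Summable.hasProdLocallyUniformlyOn_nat_one_add Metric.isOpen_ball
      ((summable_geometric_of_lt_one (norm_nonneg p) hp).mul_right (‖x‖ + 1))
      (Eventually.of_forall fun j y hy => ?_) (fun j => by fun_prop)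
    rw [norm_neg, norm_mul, norm_pow]
    exact mul_le_mul_of_nonneg_left (mem_ball_zero_iff.mp hy).le (by positivity)
  have hc : ContinuousOn (halfTheta p) (Metric.ball 0 (‖x‖ + 1)) := by
    refine TendstoLocallyUniformlyOn.continuousOn h (Frequently.of_forall fun s => ?_)
    exact continuousOn_finsetProd _ fun j _ => by fun_prop
  exact hc.continuousAt (Metric.isOpen_ball.mem_nhds (by simp))

theorem theta_eq_halfTheta {p : ℂ} (hp : ‖p‖ < 1) (x : ℂ) :
    theta x p = halfTheta p x * halfTheta p (p / x) := by
  unfold theta halfTheta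
  rw [← (multipliable_one_add_of_summable (summable_norm_halfTheta hp x)).tprod_mul
    (multipliable_one_add_of_summable (summable_norm_halfTheta hp (p / x)))]
  refine tprod_congr fun j => ?_
  ring

/-- Peeling the first factor off each half product leaves the same infinite product on both sides;
only `1 - 1/x` and `1 - x` differ. -/
theorem theta_inv {p : ℂ} (hp : ‖p‖ < 1) {x : ℂ} (hx : x ≠ 0) :
    theta x⁻¹ p = -x⁻¹ * theta x p := by
  rw [theta_eq_halfTheta hp, theta_eq_halfTheta hp, halfTheta_eq_mul hp x⁻¹,
    halfTheta_eq_mul hp x, div_inv_eq_mul, ← div_eq_mul_inv]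
  field_simp
  ring

theorem theta_eq_of_mul_eq_one {p : ℂ} (hp : ‖p‖ < 1) {x y : ℂ} (hxy : x * y = 1) :
    theta x p = -x * theta y p := by
  obtain rfl : x = y⁻¹ := eq_inv_of_mul_eq_one_left hxy
  exact theta_inv hp (right_ne_zero_of_mul_eq_one hxy)

theorem theta_one (p : ℂ) : theta 1 p = 0 :=
  tprod_of_exists_eq_zero ⟨0, by simp⟩

theorem theta_ne_zero {p : ℂ} (hp : ‖p‖ < 1) {x : ℂ} (hx0 : x ≠ 0) (hx : ∀ m : ℤ, x ≠ p ^ m) :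
    theta x p ≠ 0 := by
  rw [theta_eq_halfTheta hp]
  refine mul_ne_zero (halfTheta_ne_zero hp fun j h => ?_) (halfTheta_ne_zero hp fun j h => ?_)
  · refine hx (-(j : ℤ)) ?_
    rw [zpow_neg, zpow_natCast]
    exact eq_inv_of_mul_eq_one_right h
  · refine hx ((j + 1 : ℕ) : ℤ) ?_
    rw [zpow_natCast, pow_succ]
    field_simp at h
    exact h.symm

theorem continuousAt_theta {p : ℂ} (hp : ‖p‖ < 1) {x : ℂ} (hx : x ≠ 0) :
    ContinuousAt (fun y => theta y p) x := by
  simp only [theta_eq_halfTheta hp]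
  have h := continuous_halfTheta hp
  exact h.continuousAt.mul (h.continuousAt.comp (continuousAt_const.div continuousAt_id hx))

theorem countable_theta_zeros {p : ℂ} (hp : ‖p‖ < 1) :
    {x : ℂ | x ≠ 0 ∧ theta x p = 0}.Countable := by
  refine (Set.countable_range fun m : ℤ => p ^ m).mono fun x hx => ?_
  by_contra h
  exact theta_ne_zero hp hx.1 (fun m hm => h ⟨m, hm.symm⟩) hx.2

/-! ### Elliptic shifted factorials -/

theorem poch_zero (q p x : ℂ) : poch q p x 0 = 1 := by simp [poch]

theorem poch_succ (q p x : ℂ) (k : ℕ) :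
    poch q p x (k + 1) = poch q p x k * theta (x * q ^ k) p := by
  simp [poch, Finset.prod_range_succ]

theorem poch_add (q p x : ℂ) (k l : ℕ) :
    poch q p x (k + l) = poch q p x k * poch q p (x * q ^ k) l := by
  simp [poch, Finset.prod_range_add, pow_add, mul_assoc]

theorem poch_one (q p x : ℂ) : poch q p x 1 = theta x p := by simp [poch]

theorem poch_succ' (q p x : ℂ) (k : ℕ) :
    poch q p x (k + 1) = theta x p * poch q p (x * q) k := by
  rw [add_comm, poch_add, poch_one, pow_one]

theorem poch_ne_zero {q p x : ℂ} {k : ℕ} (h : ∀ i < k, theta (x * q ^ i) p ≠ 0) :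
    poch q p x k ≠ 0 :=
  Finset.prod_ne_zero_iff.mpr fun i hi => h i (Finset.mem_range.mp hi)

/-- The function `h_k(x;a)`, in terms of `ξ` where `x = ξ + 1/ξ`. -/
def hXi (q p : ℂ) (k : ℕ) (ξ a : ℂ) : ℂ := poch q p (a * ξ) k * poch q p (a * ξ⁻¹) k

theorem hXi_zero (q p ξ a : ℂ) : hXi q p 0 ξ a = 1 := by simp [hXi, poch_zero]

theorem hXi_add (q p : ℂ) (k l : ℕ) (ξ a : ℂ) :
    hXi q p (k + l) ξ a = hXi q p k ξ a * hXi q p l ξ (a * q ^ k) := by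
  simp only [hXi, poch_add, mul_right_comm a _ (q ^ k)]
  ring

/-! ### The elliptic binomial theorem -/

/-- By the minor formula, `h_1(x;u)` is a combination of `F(ξ)` and `G(ξ)`. All these functions lie
in a two-dimensional space, and the coefficients are given by Cramer's rule. -/
theorem hXi_one_expansion {q p : ℂ} (hp : ‖p‖ < 1) {ξ u v w : ℂ} (hξ : ξ ≠ 0) (hu : u ≠ 0)
    (hv : v ≠ 0) (hw : w ≠ 0) (h1 : theta (v * w) p ≠ 0) (h2 : theta (v / w) p ≠ 0) :
    hXi q p 1 ξ u =
      theta (u * w) p * theta (u / w) p / (theta (v * w) p * theta (v / w) p) * hXi q p 1 ξ v +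
      theta (u * v) p * theta (u / v) p / (theta (v * w) p * theta (w / v) p) * hXi q p 1 ξ w := by
  simp only [hXi, poch_one, ← div_eq_mul_inv]
  obtain ⟨F, G, h⟩ := exists_theta_mul_theta_eq hp
  rw [mul_comm v w] at h1 ⊢
  have e1 := h v w hv hw
  have e2 := h w v hw hv
  rw [mul_comm v w] at e1
  rw [h u ξ hu hξ, h v ξ hv hξ, h w ξ hw hξ, h u w hu hw, h u v hu hv, e1, e2]
  have n1 : F v * G w - G v * F w ≠ 0 := right_ne_zero_of_mul (e1 ▸ mul_ne_zero h1 h2)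
  rw [show F w * G v - G w * F v = -(F v * G w - G v * F w) by ring]
  generalize hD : F v * G w - G v * F w = D at n1
  field_simp
  linear_combination (F ξ * G u - F u * G ξ) * hD

/-- The coefficient of `h_i(x;b)h_j(x;c)` in the expansion of `h_{i+j}(x;a)`. -/
def binomCoeff (q p a b c : ℂ) (i j : ℕ) : ℂ :=
  (q ^ (i * j))⁻¹ * (poch q p q (i + j) / (poch q p q i * poch q p q j)) *
    (poch q p (a * c * q ^ j) i * poch q p (a / c) i *
      (poch q p (a * b * q ^ i) j * poch q p (a / b) j) /
    (poch q p (b / c / q ^ j) i * poch q p (c / b / q ^ i) j * poch q p (b * c) (i + j)))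

/-- The conditions on `b` and `c` under which the products `h_i(x;b)h_j(x;c)` with `i + j = n`
form a basis. -/
structure BinomGeneric (q p b c : ℂ) (n : ℕ) : Prop where
  p_lt : ‖p‖ < 1
  q_ne : q ≠ 0
  b_ne : b ≠ 0
  c_ne : c ≠ 0
  theta_q : ∀ i < n, theta (q * q ^ i) p ≠ 0
  theta_mul : ∀ i < n, theta (b * c * q ^ i) p ≠ 0
  theta_div : ∀ i j : ℕ, i < n → j < n → theta (b / c * q ^ i / q ^ j) p ≠ 0

theorem BinomGeneric.mono {q p b c : ℂ} {m n : ℕ} (h : BinomGeneric q p b c n) (hmn : m ≤ n) :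
    BinomGeneric q p b c m where
  p_lt := h.p_lt
  q_ne := h.q_ne
  b_ne := h.b_ne
  c_ne := h.c_ne
  theta_q i hi := h.theta_q i (by omega)
  theta_mul i hi := h.theta_mul i (by omega)
  theta_div i j hi hj := h.theta_div i j (by omega) (by omega)

theorem BinomGeneric.theta_div' {q p b c : ℂ} {n : ℕ} (h : BinomGeneric q p b c n) (i j : ℕ)
    (hi : i < n) (hj : j < n) : theta (c / b * q ^ i / q ^ j) p ≠ 0 := by
  have hb := h.b_ne
  have hc := h.c_ne
  have hi' := pow_ne_zero i h.q_ne
  have hj' := pow_ne_zero j h.q_ne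
  rw [theta_eq_of_mul_eq_one h.p_lt (y := b / c * q ^ j / q ^ i) (by field_simp)]
  exact mul_ne_zero (neg_ne_zero.mpr (by positivity)) (h.theta_div j i hj hi)

/-- The Pascal rule for `binomCoeff` reduces to this identity once common factors are removed; `Q`,
`I`, `J` stand for `q`, `q^i`, `q^j`. -/
theorem theta_pascal {p : ℂ} (hp : ‖p‖ < 1) {a b c Q I J : ℂ} (ha : a ≠ 0) (hb : b ≠ 0)
    (hc : c ≠ 0) (hQ : Q ≠ 0) (hI : I ≠ 0) (hJ : J ≠ 0) :
    theta (Q * Q * I * J) p * theta (a * c * Q * I * J) p * theta (a * b * Q * I * J) p *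
        theta (b / c * I / J) p =
      theta (a * c * Q * Q * I * J * J) p * theta (a * b * I) p * theta (Q * I) p *
        theta (b / c * Q * I) p +
      b / c * Q * I * (theta (a * b * Q * Q * I * I * J) p * theta (a * c * J) p *
        theta (c / b * Q * J) p * theta ((Q * J)⁻¹) p) := by
  -- The addition formula needs its arguments as products `xy` and quotients `x/y`, which forces a
  -- square root of `bc`. Only even powers of it survive in the resulting theta arguments.
  obtain ⟨s, hs⟩ := IsAlgClosed.exists_eq_mul_self (b * c)
  have hs0 : s ≠ 0 := by
    rintro rfl
    exact mul_ne_zero hb hc (by simpa using hs)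
  obtain rfl : b = s * s / c := by rw [← hs]; field_simp
  have h := theta_addition hp (x := a * s * Q * I * J) (y := c / s) (z := Q * I * s / c)
    (w := Q * J * c / s) (by positivity) (by positivity) (by positivity) (by positivity)
  rw [show a * s * Q * I * J * (c / s) = a * c * Q * I * J by field_simp,
    show a * s * Q * I * J / (c / s) = a * (s * s / c) * Q * I * J by field_simp,
    show Q * I * s / c * (Q * J * c / s) = Q * Q * I * J by field_simp,
    show Q * I * s / c / (Q * J * c / s) = s * s / c / c * I / J by field_simp,
    show a * s * Q * I * J * (Q * J * c / s) = a * c * Q * Q * I * J * J by field_simp,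
    show a * s * Q * I * J / (Q * J * c / s) = a * (s * s / c) * I by field_simp,
    show Q * I * s / c * (c / s) = Q * I by field_simp,
    show Q * I * s / c / (c / s) = s * s / c / c * Q * I by field_simp,
    show a * s * Q * I * J * (Q * I * s / c) = a * (s * s / c) * Q * Q * I * I * J by field_simp,
    show a * s * Q * I * J / (Q * I * s / c) = a * c * J by field_simp,
    show c / s * (Q * J * c / s) = c / (s * s / c) * Q * J by field_simp,
    show c / s / (Q * J * c / s) = (Q * J)⁻¹ by field_simp] at h
  linear_combination h

/-- The coefficient of `h_1(x;bq^i)` in the expansion of `h_1(x;aq^{i+j})`. -/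
def leftStep (q p a b c : ℂ) (i j : ℕ) : ℂ :=
  theta (a * c * q ^ i * q ^ j * q ^ j) p * theta (a / c * q ^ i) p /
    (theta (b * c * q ^ (i + j)) p * theta (b / c * q ^ i / q ^ j) p)

/-- The coefficient of `h_1(x;cq^j)` in the expansion of `h_1(x;aq^{i+j})`. -/
def rightStep (q p a b c : ℂ) (i j : ℕ) : ℂ :=
  theta (a * b * q ^ i * q ^ i * q ^ j) p * theta (a / b * q ^ j) p /
    (theta (b * c * q ^ (i + j)) p * theta (c / b * q ^ j / q ^ i) p)

/-- The last factor of `h_{i+j+1}(x;a)` is split so that one part extends `h_i(x;b)` and the other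
extends `h_j(x;c)`. -/
theorem hXi_one_step {q p a b c ξ : ℂ} {i j : ℕ} (h : BinomGeneric q p b c (i + j + 1))
    (ha : a ≠ 0) (hξ : ξ ≠ 0) :
    hXi q p 1 ξ (a * q ^ (i + j)) = leftStep q p a b c i j * hXi q p 1 ξ (b * q ^ i) +
      rightStep q p a b c i j * hXi q p 1 ξ (c * q ^ j) := by
  have hq := h.q_ne
  have hb := h.b_ne
  have hc := h.c_ne
  have e1 : b * q ^ i * (c * q ^ j) = b * c * q ^ (i + j) := by ring
  have e2 : b * q ^ i / (c * q ^ j) = b / c * q ^ i / q ^ j := by field_simp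
  have e3 : c * q ^ j / (b * q ^ i) = c / b * q ^ j / q ^ i := by field_simp
  have e4 : a * q ^ (i + j) * (c * q ^ j) = a * c * q ^ i * q ^ j * q ^ j := by ring
  have e5 : a * q ^ (i + j) / (c * q ^ j) = a / c * q ^ i := by rw [pow_add]; field_simp
  have e6 : a * q ^ (i + j) * (b * q ^ i) = a * b * q ^ i * q ^ i * q ^ j := by ring
  have e7 : a * q ^ (i + j) / (b * q ^ i) = a / b * q ^ j := by rw [pow_add]; field_simp
  have key := hXi_one_expansion (q := q) h.p_lt (u := a * q ^ (i + j)) (v := b * q ^ i)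
    (w := c * q ^ j) hξ (by positivity) (by positivity) (by positivity)
    (by rw [e1]; exact h.theta_mul _ (by omega))
    (by rw [e2]; exact h.theta_div _ _ (by omega) (by omega))
  rw [e1, e2, e3, e4, e5, e6, e7] at key
  exact key

theorem binomCoeff_zero_succ {q p : ℂ} (a b c : ℂ) {j : ℕ}
    (h : ∀ i < j + 1, theta (q * q ^ i) p ≠ 0) :
    binomCoeff q p a b c 0 (j + 1) = rightStep q p a b c 0 j * binomCoeff q p a b c 0 j := by
  have h0 := poch_ne_zero h
  have h1 := poch_ne_zero fun i (hi : i < j) => h i (by omega)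
  simp only [binomCoeff, rightStep, zero_mul, zero_add, pow_zero, inv_one, one_mul, mul_one,
    div_one, poch_zero, div_self h0, div_self h1]
  simp only [poch_succ]
  ring

theorem binomCoeff_succ_zero {q p : ℂ} (a b c : ℂ) {i : ℕ}
    (h : ∀ j < i + 1, theta (q * q ^ j) p ≠ 0) :
    binomCoeff q p a b c (i + 1) 0 = leftStep q p a b c i 0 * binomCoeff q p a b c i 0 := by
  have h0 := poch_ne_zero h
  have h1 := poch_ne_zero fun j (hj : j < i) => h j (by omega)
  simp only [binomCoeff, leftStep, mul_zero, add_zero, pow_zero, inv_one, one_mul, mul_one,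
    div_one, poch_zero, div_self h0, div_self h1]
  simp only [poch_succ]
  ring

theorem binomCoeff_succ_succ {q p a b c : ℂ} {i j : ℕ} (h : BinomGeneric q p b c (i + j + 2))
    (ha : a ≠ 0) :
    binomCoeff q p a b c (i + 1) (j + 1) =
      leftStep q p a b c i (j + 1) * binomCoeff q p a b c i (j + 1) +
      rightStep q p a b c (i + 1) j * binomCoeff q p a b c (i + 1) j := by
  have hp := h.p_lt
  have hq := h.q_ne
  have hb := h.b_ne
  have hc := h.c_ne
  have pascal := theta_pascal hp ha hb hc hq (pow_ne_zero i hq) (pow_ne_zero j hq)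
  have k1 : q ^ ((i + 1) * (j + 1)) = q ^ (i * j) * q ^ i * q ^ j * q := by ring
  have k2 : q ^ (i * (j + 1)) = q ^ (i * j) * q ^ i := by ring
  have k3 : q ^ ((i + 1) * j) = q ^ (i * j) * q ^ j := by ring
  have e0 : theta (c / b * q * q ^ j) p = -(c / b * q * q ^ j) * theta (b / c / q ^ (j + 1)) p :=
    theta_eq_of_mul_eq_one hp (by rw [pow_succ]; field_simp)
  have f0 : theta (b / c * q * q ^ i) p = -(b / c * q * q ^ i) * theta (c / b / q ^ (i + 1)) p :=
    theta_eq_of_mul_eq_one hp (by rw [pow_succ]; field_simp)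
  have f2 : theta (c / b * q ^ j / q ^ i) p =
      -(c / b * q ^ j / q ^ i) * theta (b / c * q ^ i / q ^ j) p :=
    theta_eq_of_mul_eq_one hp (by field_simp)
  have tj := theta_inv hp (mul_ne_zero hq (pow_ne_zero j hq))
  have n0 : theta (b / c / q ^ (j + 1)) p ≠ 0 := by
    simpa using h.theta_div 0 (j + 1) (by omega) (by omega)
  have n1 := h.theta_div i (j + 1) (by omega) (by omega)
  have n2 := h.theta_div i j (by omega) (by omega)
  have m0 : theta (c / b / q ^ (i + 1)) p ≠ 0 := by
    simpa using h.theta_div' 0 (i + 1) (by omega) (by omega)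
  have m1 := h.theta_div' j (i + 1) (by omega) (by omega)
  have nE : poch q p (b / c / q ^ j) i ≠ 0 := poch_ne_zero fun t ht => by
    rw [div_mul_eq_mul_div]; exact h.theta_div t j (by omega) (by omega)
  have nF : poch q p (c / b / q ^ i) j ≠ 0 := poch_ne_zero fun t ht => by
    rw [div_mul_eq_mul_div]; exact h.theta_div' t i (by omega) (by omega)
  have nqi : poch q p q i ≠ 0 := poch_ne_zero fun t ht => h.theta_q t (by omega)
  have nqj : poch q p q j ≠ 0 := poch_ne_zero fun t ht => h.theta_q t (by omega)
  have nti := h.theta_q i (by omega)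
  have ntj := h.theta_q j (by omega)
  have nD : poch q p (b * c) (i + j + 1) ≠ 0 :=
    poch_ne_zero fun t ht => h.theta_mul t (by omega)
  have nbc := h.theta_mul (i + j + 1) (by omega)
  -- Shifted factorials whose bases differ by one power of `q` overlap in all but their end factors.
  -- This expresses all three coefficients through the same shifted factorials and a few single
  -- theta values.
  have r1 : poch q p (b / c / q ^ (j + 1)) (i + 1) =
      theta (b / c / q ^ (j + 1)) p * poch q p (b / c / q ^ j) i := by
    rw [poch_succ', pow_succ]; congr 2; field_simp
  have r2 : poch q p (b / c / q ^ (j + 1)) i =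
      theta (b / c / q ^ (j + 1)) p * poch q p (b / c / q ^ j) i /
        theta (b / c * q ^ i / q ^ (j + 1)) p := by
    rw [← r1, poch_succ, div_mul_eq_mul_div, mul_div_cancel_right₀ _ n1]
  have r3 : poch q p (c / b / q ^ (i + 1)) (j + 1) =
      theta (c / b / q ^ (i + 1)) p * poch q p (c / b / q ^ i) j := by
    rw [poch_succ', pow_succ]; congr 2; field_simp
  have r4 : poch q p (c / b / q ^ (i + 1)) j =
      theta (c / b / q ^ (i + 1)) p * poch q p (c / b / q ^ i) j /
        theta (c / b * q ^ j / q ^ (i + 1)) p := by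
    rw [← r3, poch_succ, div_mul_eq_mul_div, mul_div_cancel_right₀ _ m1]
  have r5 : poch q p (c / b / q ^ i) (j + 1) =
      poch q p (c / b / q ^ i) j * theta (c / b * q ^ j / q ^ i) p := by
    rw [poch_succ, div_mul_eq_mul_div]
  have r6 : poch q p (b / c / q ^ j) (i + 1) =
      poch q p (b / c / q ^ j) i * theta (b / c * q ^ i / q ^ j) p := by
    rw [poch_succ, div_mul_eq_mul_div]
  have s1 : poch q p (a * c * q ^ (j + 1)) (i + 1) =
      poch q p (a * c * q ^ (j + 1)) i * theta (a * c * q * q ^ i * q ^ j) p := by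
    rw [poch_succ]; congr 2; ring
  have s2 : poch q p (a * c * q ^ j) (i + 1) =
      theta (a * c * q ^ j) p * poch q p (a * c * q ^ (j + 1)) i := by
    rw [poch_succ']; congr 2; ring
  have s3 : poch q p (a * b * q ^ (i + 1)) (j + 1) =
      poch q p (a * b * q ^ (i + 1)) j * theta (a * b * q * q ^ i * q ^ j) p := by
    rw [poch_succ]; congr 2; ring
  have s4 : poch q p (a * b * q ^ i) (j + 1) =
      theta (a * b * q ^ i) p * poch q p (a * b * q ^ (i + 1)) j := by
    rw [poch_succ']; congr 2; ring
  have t1 : poch q p q (i + 1 + (j + 1)) =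
      poch q p q (i + j + 1) * theta (q * q * q ^ i * q ^ j) p := by
    rw [show i + 1 + (j + 1) = i + j + 1 + 1 by ring, poch_succ]; congr 2; ring
  have t2 : poch q p (b * c) (i + 1 + (j + 1)) =
      poch q p (b * c) (i + j + 1) * theta (b * c * q ^ (i + j + 1)) p := by
    rw [show i + 1 + (j + 1) = i + j + 1 + 1 by ring, poch_succ]
  have u1 : a * c * q ^ i * q ^ (j + 1) * q ^ (j + 1) = a * c * q * q * q ^ i * q ^ j * q ^ j := by
    ring
  have u2 : a * b * q ^ (i + 1) * q ^ (i + 1) * q ^ j = a * b * q * q * q ^ i * q ^ i * q ^ j := by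
    ring
  have w1 : i + (j + 1) = i + j + 1 := by ring
  have w2 : i + 1 + j = i + j + 1 := by ring
  rw [tj, e0, f0] at pascal
  unfold binomCoeff leftStep rightStep
  rw [t1, t2, w1, w2, k1, k2, k3, s1, s2, s3, s4, r1, r2, r3, r4, r5, r6, u1, u2, f2,
    poch_succ q p q i, poch_succ q p q j, poch_succ q p (a / c) i, poch_succ q p (a / b) j]
  have hX := pow_ne_zero (i * j) hq
  have hI := pow_ne_zero i hq
  have hJ := pow_ne_zero j hq
  clear * - pascal n0 n1 n2 m0 m1 nE nF nqi nqj nti ntj nD nbc hX hI hJ hq hb hc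
  generalize theta (b / c / q ^ (j + 1)) p = e0 at *
  generalize theta (b / c * q ^ i / q ^ (j + 1)) p = e1 at *
  generalize theta (b / c * q ^ i / q ^ j) p = e2 at *
  generalize theta (c / b / q ^ (i + 1)) p = f0 at *
  generalize theta (c / b * q ^ j / q ^ (i + 1)) p = f1 at *
  generalize theta (q * q ^ i) p = ti at *
  generalize theta (q * q ^ j) p = tj at *
  generalize theta (b * c * q ^ (i + j + 1)) p = tbc at *
  generalize poch q p (b / c / q ^ j) i = E at *
  generalize poch q p (c / b / q ^ i) j = F at *
  generalize poch q p (b * c) (i + j + 1) = D at *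
  generalize poch q p q i = Bi at *
  generalize poch q p q j = Bj at *
  generalize poch q p q (i + j + 1) = B at *
  generalize poch q p (a * c * q ^ (j + 1)) i = P1 at *
  generalize poch q p (a / c) i = P2 at *
  generalize poch q p (a / b) j = P3 at *
  generalize poch q p (a * b * q ^ (i + 1)) j = P4 at *
  generalize theta (a * c * q * q ^ i * q ^ j) p = t1 at *
  generalize theta (a * b * q * q ^ i * q ^ j) p = t3 at *
  generalize theta (a / c * q ^ i) p = t2 at *
  generalize theta (a / b * q ^ j) p = t4 at *
  generalize theta (a * c * q ^ j) p = t6 at *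
  generalize theta (a * b * q ^ i) p = t5 at *
  generalize theta (a * c * q * q * q ^ i * q ^ j * q ^ j) p = t7 at *
  generalize theta (a * b * q * q * q ^ i * q ^ i * q ^ j) p = t8 at *
  generalize theta (q * q * q ^ i * q ^ j) p = tq at *
  generalize q ^ (i * j) = X at *
  generalize q ^ i = I at *
  generalize q ^ j = J at *
  -- The multiplier is the part common to all three terms; with theta values as free variables,
  -- `pascal` is the only relation left.
  linear_combination (norm := skip)
    (X⁻¹ * B / (Bi * Bj) * P1 * P2 * P3 * P4 / (E * F * D) * t2 * t4 /
      (q * I * J * ti * tj * e0 * f0 * tbc * e2)) * pascal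
  field_simp
  ring

/-- The elliptic binomial theorem. -/
theorem hXi_eq_sum_antidiagonal {q p a b c ξ : ℂ} {n : ℕ} (h : BinomGeneric q p b c n)
    (ha : a ≠ 0) (hξ : ξ ≠ 0) :
    hXi q p n ξ a = ∑ z ∈ Finset.HasAntidiagonal.antidiagonal n,
      binomCoeff q p a b c z.1 z.2 * (hXi q p z.1 ξ b * hXi q p z.2 ξ c) := by
  induction n with
  | zero => simp [hXi_zero, binomCoeff, poch_zero]
  | succ n ih =>
    -- Extending the two contributions by zero makes the Pascal rule hold on the boundary `i = 0` or
    -- `j = 0` as well.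
    let L : ℕ → ℕ → ℂ
      | 0, _ => 0
      | i + 1, j => leftStep q p a b c i j * binomCoeff q p a b c i j
    let R : ℕ → ℕ → ℂ
      | _, 0 => 0
      | i, j + 1 => rightStep q p a b c i j * binomCoeff q p a b c i j
    have hLR : ∀ z ∈ Finset.HasAntidiagonal.antidiagonal (n + 1),
        binomCoeff q p a b c z.1 z.2 = L z.1 z.2 + R z.1 z.2 := by
      rintro ⟨i, j⟩ hz
      rw [Finset.HasAntidiagonal.mem_antidiagonal] at hz
      rcases i with _ | i <;> rcases j with _ | j
      · simp at hz
      · have hz' : j = n := by simpa using hz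
        rw [binomCoeff_zero_succ a b c (hz' ▸ h.theta_q)]
        simp [L, R]
      · have hz' : i = n := by simpa using hz
        rw [binomCoeff_succ_zero a b c (hz' ▸ h.theta_q)]
        simp [L, R]
      · exact binomCoeff_succ_succ (h.mono (by simp only at hz; omega)) ha
    rw [Finset.sum_congr rfl fun z hz => by rw [hLR z hz, add_mul], Finset.sum_add_distrib,
      Finset.Nat.sum_antidiagonal_succ, Finset.Nat.sum_antidiagonal_succ', hXi_add,
      ih (h.mono n.le_succ), Finset.sum_mul]
    simp only [L, R, zero_mul, zero_add, ← Finset.sum_add_distrib]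
    refine Finset.sum_congr rfl fun z hz => ?_
    obtain ⟨i, j⟩ := z
    rw [Finset.HasAntidiagonal.mem_antidiagonal] at hz
    simp only at hz
    subst hz
    rw [hXi_one_step h ha hξ, hXi_add q p i 1, hXi_add q p j 1]
    ring

/-! ### Ratios of binomial coefficients and of series terms -/

theorem theta_ne_zero_of_mul_eq_one {p : ℂ} (hp : ‖p‖ < 1) {x y : ℂ} (hxy : x * y = 1)
    (hy : theta y p ≠ 0) : theta x p ≠ 0 := by
  rw [theta_eq_of_mul_eq_one hp hxy]
  exact mul_ne_zero (neg_ne_zero.mpr (left_ne_zero_of_mul_eq_one hxy)) hy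

/-- When the summation index `j` of the double expansion increases, the first binomial coefficient
changes by such a step along an antidiagonal. -/
theorem binomCoeff_succ_left {q p a b c : ℂ} {i j : ℕ} (hp : ‖p‖ < 1) (hq : q ≠ 0) (hb : b ≠ 0)
    (hc : c ≠ 0) (hqj : theta (q * q ^ j) p ≠ 0)
    (hab : theta (a * b * q ^ i) p ≠ 0) (hab' : theta (a / b * q ^ j) p ≠ 0)
    (n0 : theta (b / c / q ^ (j + 1)) p ≠ 0)
    (n1 : theta (b / c * q ^ i / q ^ (j + 1)) p ≠ 0)
    (m1 : theta (c / b * q ^ j / q ^ (i + 1)) p ≠ 0) :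
    binomCoeff q p a b c (i + 1) j = binomCoeff q p a b c i (j + 1) *
      (-(c / b) * (theta (q * q ^ j) p * theta (a * c * q ^ j) p * theta (a / c * q ^ i) p *
        theta (b / c / q ^ (j + 1)) p * theta (c / b * q ^ j / q ^ (i + 1)) p) /
      (theta (q * q ^ i) p * theta (a * b * q ^ i) p * theta (a / b * q ^ j) p *
        theta (b / c * q ^ i / q ^ (j + 1)) p * theta (c / b / q ^ (i + 1)) p)) := by
  have k2 : q ^ (i * (j + 1)) = q ^ (i * j) * q ^ i := by ring
  have k3 : q ^ ((i + 1) * j) = q ^ (i * j) * q ^ j := by ring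
  have f2 : theta (c / b * q ^ j / q ^ i) p =
      -(c / b * q ^ j / q ^ i) * theta (b / c * q ^ i / q ^ j) p :=
    theta_eq_of_mul_eq_one hp (by field_simp)
  have r2 : poch q p (b / c / q ^ (j + 1)) i =
      theta (b / c / q ^ (j + 1)) p * poch q p (b / c / q ^ j) i /
        theta (b / c * q ^ i / q ^ (j + 1)) p := by
    have : poch q p (b / c / q ^ (j + 1)) (i + 1) =
        theta (b / c / q ^ (j + 1)) p * poch q p (b / c / q ^ j) i := by
      rw [poch_succ', pow_succ]; congr 2; field_simp
    rw [← this, poch_succ, div_mul_eq_mul_div, mul_div_cancel_right₀ _ n1]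
  have r4 : poch q p (c / b / q ^ (i + 1)) j =
      theta (c / b / q ^ (i + 1)) p * poch q p (c / b / q ^ i) j /
        theta (c / b * q ^ j / q ^ (i + 1)) p := by
    have : poch q p (c / b / q ^ (i + 1)) (j + 1) =
        theta (c / b / q ^ (i + 1)) p * poch q p (c / b / q ^ i) j := by
      rw [poch_succ', pow_succ]; congr 2; field_simp
    rw [← this, poch_succ, div_mul_eq_mul_div, mul_div_cancel_right₀ _ m1]
  have r5 : poch q p (c / b / q ^ i) (j + 1) =
      poch q p (c / b / q ^ i) j * theta (c / b * q ^ j / q ^ i) p := by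
    rw [poch_succ, div_mul_eq_mul_div]
  have r6 : poch q p (b / c / q ^ j) (i + 1) =
      poch q p (b / c / q ^ j) i * theta (b / c * q ^ i / q ^ j) p := by
    rw [poch_succ, div_mul_eq_mul_div]
  have s2 : poch q p (a * c * q ^ j) (i + 1) =
      theta (a * c * q ^ j) p * poch q p (a * c * q ^ (j + 1)) i := by
    rw [poch_succ']; congr 2; ring
  have s4 : poch q p (a * b * q ^ i) (j + 1) =
      theta (a * b * q ^ i) p * poch q p (a * b * q ^ (i + 1)) j := by
    rw [poch_succ']; congr 2; ring
  have w1 : i + (j + 1) = i + j + 1 := by ring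
  have w2 : i + 1 + j = i + j + 1 := by ring
  unfold binomCoeff
  rw [w1, w2, k2, k3, s2, s4, r2, r4, r5, r6, f2,
    poch_succ q p q i, poch_succ q p q j, poch_succ q p (a / c) i, poch_succ q p (a / b) j]
  have hX := pow_ne_zero (i * j) hq
  have hI := pow_ne_zero i hq
  have hJ := pow_ne_zero j hq
  clear * - hqj hab hab' n0 n1 m1 hX hI hJ hq hb hc
  generalize theta (b / c / q ^ (j + 1)) p = e0 at *
  generalize theta (b / c * q ^ i / q ^ (j + 1)) p = e1 at *
  generalize theta (b / c * q ^ i / q ^ j) p = e2 at *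
  generalize theta (c / b / q ^ (i + 1)) p = f0 at *
  generalize theta (c / b * q ^ j / q ^ (i + 1)) p = f1 at *
  generalize theta (q * q ^ j) p = g0 at *
  generalize theta (a * c * q ^ j) p = g1 at *
  generalize theta (a / c * q ^ i) p = g2 at *
  generalize theta (q * q ^ i) p = g3 at *
  generalize theta (a * b * q ^ i) p = g4 at *
  generalize theta (a / b * q ^ j) p = g5 at *
  generalize poch q p q (i + j + 1) = g6 at *
  generalize poch q p q i = g7 at *
  generalize poch q p q j = g8 at *
  generalize poch q p (a * c * q ^ (j + 1)) i = g9 at *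
  generalize poch q p (a / c) i = g10 at *
  generalize poch q p (a * b * q ^ (i + 1)) j = g11 at *
  generalize poch q p (a / b) j = g12 at *
  generalize poch q p (b / c / q ^ j) i = g13 at *
  generalize poch q p (c / b / q ^ i) j = g14 at *
  generalize poch q p (b * c) (i + j + 1) = g15 at *
  generalize q ^ (i * j) = g16 at *
  generalize q ^ i = I at *
  generalize q ^ j = J at *
  have key : J⁻¹ = I⁻¹ * g0⁻¹ * g4 * g5 * (e0 / e1 * (-(c / b * J / I)))⁻¹ *
      (-(c / b) * (g0 * e0) / (g4 * g5 * e1)) := by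
    field_simp
  linear_combination (norm := (simp only [div_eq_mul_inv, mul_inv, inv_inv]; ring))
    (g16⁻¹ * g6 / (g7 * g8) * g9 * g10 * g11 * g12 / (g13 * g14 * g15) *
    g1 * g2 * f1 / (g3 * e2 * f0)) * key

/-- This is the companion step for the second binomial coefficient, whose base `cq^j` moves to
`cq^{j+1}` while its left index drops by one. -/
theorem binomCoeff_shift_left {q p a b c : ℂ} {i j : ℕ} (hq : q ≠ 0)
    (h1 : theta (q * q ^ i) p ≠ 0) (h2 : theta (q * q ^ (i + j)) p ≠ 0)
    (h3 : theta (a * c * q ^ j * q ^ i) p ≠ 0) (h4 : theta (a / c * q ^ i) p ≠ 0)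
    (h5 : theta (b / c / q ^ j) p ≠ 0) (h6 : theta (b * c) p ≠ 0)
    (h7 : theta (a / b / q * q ^ j) p ≠ 0) :
    binomCoeff q p a (b * q) c i j = binomCoeff q p a b c (i + 1) j *
      (q ^ j * (theta (q * q ^ i) p * theta (a / b / q) p * theta (b / c / q ^ j) p *
        theta (b * c) p) /
      (theta (q * q ^ (i + j)) p * theta (a * c * q ^ j * q ^ i) p * theta (a / c * q ^ i) p *
        theta (a / b / q * q ^ j) p)) := by
  have k3 : q ^ ((i + 1) * j) = q ^ (i * j) * q ^ j := by ring
  have w2 : i + 1 + j = i + j + 1 := by ring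
  have r1 : poch q p (a / (b * q)) j =
      theta (a / b / q) p * poch q p (a / b) j / theta (a / b / q * q ^ j) p := by
    have : poch q p (a / b / q) (j + 1) = theta (a / b / q) p * poch q p (a / b) j := by
      rw [poch_succ', div_mul_cancel₀ _ hq]
    rw [← this, poch_succ, mul_div_cancel_right₀ _ h7, div_div]
  have r2 : poch q p (b / c / q ^ j) (i + 1) =
      theta (b / c / q ^ j) p * poch q p (b * q / c / q ^ j) i := by
    rw [poch_succ']; congr 2; ring
  have r3 : c / (b * q) / q ^ i = c / b / q ^ (i + 1) := by
    rw [pow_succ]; field_simp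
  have r4 : a * (b * q) * q ^ i = a * b * q ^ (i + 1) := by ring
  have r5 : poch q p (b * c) (i + j + 1) =
      theta (b * c) p * poch q p (b * q * c) (i + j) := by
    rw [poch_succ']; congr 2; ring
  unfold binomCoeff
  rw [w2, k3, r1, r2, r3, r4, r5, poch_succ q p q i, poch_succ q p q (i + j),
    poch_succ q p (a * c * q ^ j) i, poch_succ q p (a / c) i]
  have hX := pow_ne_zero (i * j) hq
  have hJ := pow_ne_zero j hq
  clear * - h1 h2 h3 h4 h5 h6 h7 hX hJ hq
  generalize theta (q * q ^ i) p = g0 at *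
  generalize theta (q * q ^ (i + j)) p = g1 at *
  generalize theta (a * c * q ^ j * q ^ i) p = g2 at *
  generalize theta (a / c * q ^ i) p = g3 at *
  generalize theta (b / c / q ^ j) p = g4 at *
  generalize theta (b * c) p = g5 at *
  generalize theta (a / b / q * q ^ j) p = g6 at *
  generalize theta (a / b / q) p = g7 at *
  generalize poch q p q (i + j) = g8 at *
  generalize poch q p q i = g9 at *
  generalize poch q p q j = g10 at *
  generalize poch q p (a * c * q ^ j) i = g11 at *
  generalize poch q p (a / c) i = g12 at *
  generalize poch q p (a * b * q ^ (i + 1)) j = g13 at *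
  generalize poch q p (a / b) j = g14 at *
  generalize poch q p (b * q / c / q ^ j) i = g15 at *
  generalize poch q p (c / b / q ^ (i + 1)) j = g16 at *
  generalize poch q p (b * q * c) (i + j) = g17 at *
  generalize q ^ (i * j) = g18 at *
  generalize q ^ j = J at *
  field_simp

/-- The terms of the series `V12`. -/
def V12Term (q p : ℂ) (n : ℕ) (a b c d e f g : ℂ) (k : ℕ) : ℂ :=
  theta (a * q ^ (2 * k)) p / theta a p *
      ((poch q p a k * poch q p b k * poch q p c k * poch q p d k * poch q p e k *
          poch q p f k * poch q p g k * poch q p (q ^ (-(n : ℤ))) k) /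
        (poch q p q k * poch q p (a * q / b) k * poch q p (a * q / c) k *
          poch q p (a * q / d) k * poch q p (a * q / e) k * poch q p (a * q / f) k *
          poch q p (a * q / g) k * poch q p (a * q ^ (n + 1)) k)) *
      q ^ k

theorem V12_eq_sum (q p : ℂ) (n : ℕ) (a b c d e f g : ℂ) :
    V12 q p n a b c d e f g = ∑ k ∈ Finset.range (n + 1), V12Term q p n a b c d e f g k := rfl

theorem V12Term_zero {q p a : ℂ} (n : ℕ) (b c d e f g : ℂ) (h : theta a p ≠ 0) :
    V12Term q p n a b c d e f g 0 = 1 := by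
  simp [V12Term, poch_zero, h]

theorem V12Term_succ {q p a : ℂ} (n : ℕ) (b c d e f g : ℂ) {k : ℕ}
    (h : theta (a * q ^ (2 * k)) p ≠ 0) :
    V12Term q p n a b c d e f g (k + 1) = V12Term q p n a b c d e f g k *
      (theta (a * q ^ (2 * (k + 1))) p / theta (a * q ^ (2 * k)) p *
      ((theta (a * q ^ k) p * theta (b * q ^ k) p * theta (c * q ^ k) p * theta (d * q ^ k) p *
          theta (e * q ^ k) p * theta (f * q ^ k) p * theta (g * q ^ k) p *
          theta (q ^ (-(n : ℤ)) * q ^ k) p) /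
        (theta (q * q ^ k) p * theta (a * q / b * q ^ k) p * theta (a * q / c * q ^ k) p *
          theta (a * q / d * q ^ k) p * theta (a * q / e * q ^ k) p * theta (a * q / f * q ^ k) p *
          theta (a * q / g * q ^ k) p * theta (a * q ^ (n + 1) * q ^ k) p)) * q) := by
  unfold V12Term
  simp only [poch_succ, pow_succ q k]
  generalize theta (a * q ^ (2 * k)) p = t0 at *
  generalize theta a p = t1 at *
  generalize theta (a * q ^ (2 * (k + 1))) p = t2 at *
  generalize poch q p a k = t3 at *
  generalize theta (a * q ^ k) p = t4 at *
  generalize poch q p b k = t5 at *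
  generalize theta (b * q ^ k) p = t6 at *
  generalize poch q p c k = t7 at *
  generalize theta (c * q ^ k) p = t8 at *
  generalize poch q p d k = t9 at *
  generalize theta (d * q ^ k) p = t10 at *
  generalize poch q p e k = t11 at *
  generalize theta (e * q ^ k) p = t12 at *
  generalize poch q p f k = t13 at *
  generalize theta (f * q ^ k) p = t14 at *
  generalize poch q p g k = t15 at *
  generalize theta (g * q ^ k) p = t16 at *
  generalize poch q p (q ^ (-(n : ℤ))) k = t17 at *
  generalize theta ((q ^ (-(n : ℤ))) * q ^ k) p = t18 at *
  generalize poch q p q k = t19 at *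
  generalize theta (q * q ^ k) p = t20 at *
  generalize poch q p (a * q / b) k = t21 at *
  generalize theta (a * q / b * q ^ k) p = t22 at *
  generalize poch q p (a * q / c) k = t23 at *
  generalize theta (a * q / c * q ^ k) p = t24 at *
  generalize poch q p (a * q / d) k = t25 at *
  generalize theta (a * q / d * q ^ k) p = t26 at *
  generalize poch q p (a * q / e) k = t27 at *
  generalize theta (a * q / e * q ^ k) p = t28 at *
  generalize poch q p (a * q / f) k = t29 at *
  generalize theta (a * q / f * q ^ k) p = t30 at *
  generalize poch q p (a * q / g) k = t31 at *
  generalize theta (a * q / g * q ^ k) p = t32 at *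
  generalize poch q p (a * q ^ (n + 1)) k = t33 at *
  generalize theta (a * q ^ (n + 1) * q ^ k) p = t34 at *
  have key : t2 / t1 = t0 / t1 * (t2 / t0) := by field_simp
  linear_combination (t3 * t4 * (t5 * t6) * (t7 * t8) * (t9 * t10) * (t11 * t12) * (t13 * t14) *
    (t15 * t16) * (t17 * t18) / (t19 * t20 * (t21 * t22) * (t23 * t24) * (t25 * t26) *
    (t27 * t28) * (t29 * t30) * (t31 * t32) * (t33 * t34)) * (q ^ k * q)) * key

theorem poch_eq_zero {q p x : ℂ} {i k : ℕ} (hik : i < k) (h : x * q ^ i = 1) :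
    poch q p x k = 0 :=
  Finset.prod_eq_zero (Finset.mem_range.mpr hik) (by rw [h, theta_one])

/-- Each theta function on one side has a partner on the other whose argument is equal or inverse,
so only monomials have to be compared. The capitals stand for `q` and the powers `q^j`, `q^k`,
`q^l`, `q^r`, `q^s`. The relation `KS = LR` encodes that both index decompositions have total `N`.
-/
theorem ratio_identity {p : ℂ} (hp : ‖p‖ < 1) {a b c d Q J K L R S : ℂ} (ha : a ≠ 0) (hb : b ≠ 0)
    (hc : c ≠ 0) (hd : d ≠ 0) (hQ : Q ≠ 0) (hJ : J ≠ 0) (hK : K ≠ 0) (hL : L ≠ 0) (hR : R ≠ 0)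
    (hS : S ≠ 0) (hSR : K * S = L * R) :
    (-(b * S / c) * (theta (Q * K) p * theta (a * (b * S) * K) p * theta (a / (b * S) * J) p *
        theta (c / (b * S) / (K * Q)) p * theta (b * S / c * K / (J * Q)) p) /
      (theta (Q * J) p * theta (a * c * J) p * theta (a / c * K) p *
        theta (c / (b * S) * J / (K * Q)) p * theta (b * S / c / (J * Q)) p)) *
    (R * (theta (Q * L) p * theta (b / (c * J) / Q) p * theta (c * J / d / R) p *
        theta (c * J * d) p) /
      (theta (Q * (L * R)) p * theta (b * d * R * L) p * theta (b / d * L) p *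
        theta (b / (c * J) / Q * R) p)) =
    theta ((J * Q * K * S)⁻¹ * c / b * (J * Q) ^ 2) p / theta ((J * Q * K * S)⁻¹ * c / b * J ^ 2) p *
      ((theta ((J * Q * K * S)⁻¹ * c / b * J) p * theta ((J * Q * L)⁻¹ * J) p *
          theta (S⁻¹ * a / b * J) p * theta (R⁻¹ * c / d * J) p *
          theta (c * d * J) p * theta (Q * (J * Q * K * S)⁻¹ / (a * b) * J) p *
          theta (Q * c / b * J) p * theta ((J * Q * K)⁻¹ * J) p) /
        (theta (Q * J) p * theta ((J * Q * K * S)⁻¹ * c / b * Q / (J * Q * L)⁻¹ * J) p *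
          theta ((J * Q * K * S)⁻¹ * c / b * Q / (S⁻¹ * a / b) * J) p *
          theta ((J * Q * K * S)⁻¹ * c / b * Q / (R⁻¹ * c / d) * J) p *
          theta ((J * Q * K * S)⁻¹ * c / b * Q / (c * d) * J) p *
          theta ((J * Q * K * S)⁻¹ * c / b * Q / (Q * (J * Q * K * S)⁻¹ / (a * b)) * J) p *
          theta ((J * Q * K * S)⁻¹ * c / b * Q / (Q * c / b) * J) p *
          theta ((J * Q * K * S)⁻¹ * c / b * (J * Q * K * Q) * J) p)) * Q := by
  obtain rfl : S = L * R / K := by field_simp; linear_combination hSR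
  have inv := @theta_eq_of_mul_eq_one p hp
  set S := L * R / K with hSdef
  rw [inv (x := (J * Q * K * S)⁻¹ * c / b * (J * Q) ^ 2) (y := b * S / c * K / (J * Q))
      (by field_simp),
    inv (x := (J * Q * L)⁻¹ * J) (y := Q * L) (by field_simp),
    inv (x := Q * (J * Q * K * S)⁻¹ / (a * b) * J) (y := a * (b * S) * K) (by field_simp),
    inv (x := Q * c / b * J) (y := b / (c * J) / Q) (by field_simp),
    inv (x := (J * Q * K)⁻¹ * J) (y := Q * K) (by field_simp),
    inv (x := (J * Q * K * S)⁻¹ * c / b * Q / (J * Q * L)⁻¹ * J) (y := b / (c * J) / Q * R)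
      (by rw [hSdef]; field_simp),
    inv (x := (J * Q * K * S)⁻¹ * c / b * Q / (S⁻¹ * a / b) * J) (y := a / c * K) (by field_simp),
    inv (x := (J * Q * K * S)⁻¹ * c / b * Q / (R⁻¹ * c / d) * J) (y := b / d * L)
      (by rw [hSdef]; field_simp),
    inv (x := (J * Q * K * S)⁻¹ * c / b * Q / (c * d) * J) (y := b * d * R * L)
      (by rw [hSdef]; field_simp),
    inv (x := (J * Q * K * S)⁻¹ * c / b * Q / (Q * c / b) * J) (y := Q * (L * R))
      (by rw [hSdef]; field_simp),
    inv (x := (J * Q * K * S)⁻¹ * c / b * (J * Q * K * Q) * J) (y := b * S / c / (J * Q))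
      (by field_simp),
    show (J * Q * K * S)⁻¹ * c / b * J ^ 2 = c / (b * S) * J / (K * Q) by field_simp,
    show (J * Q * K * S)⁻¹ * c / b * J = c / (b * S) / (K * Q) by field_simp,
    show S⁻¹ * a / b * J = a / (b * S) * J by field_simp,
    show R⁻¹ * c / d * J = c * J / d / R by field_simp,
    show c * d * J = c * J * d by ring,
    show (J * Q * K * S)⁻¹ * c / b * Q / (Q * (J * Q * K * S)⁻¹ / (a * b)) * J = a * c * J by
      field_simp]
  generalize theta (b * S / c * K / (J * Q)) p = t1
  generalize theta (Q * L) p = t2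
  generalize theta (a * (b * S) * K) p = t3
  generalize theta (b / (c * J) / Q) p = t4
  generalize theta (Q * K) p = t5
  generalize theta (b / (c * J) / Q * R) p = t6
  generalize theta (a / c * K) p = t7
  generalize theta (b / d * L) p = t8
  generalize theta (b * d * R * L) p = t9
  generalize theta (Q * (L * R)) p = t10
  generalize theta (b * S / c / (J * Q)) p = t11
  generalize theta (c / (b * S) * J / (K * Q)) p = t12
  generalize theta (c / (b * S) / (K * Q)) p = t13
  generalize theta (a / (b * S) * J) p = t14
  generalize theta (c * J / d / R) p = t15
  generalize theta (c * J * d) p = t16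
  generalize theta (a * c * J) p = t17
  generalize theta (Q * J) p = t18
  -- The monomials produced by the inversions cancel against the explicit factors.
  have key : -(b * S / c) * R =
      -((J * Q * K * S)⁻¹ * c / b * (J * Q) ^ 2) * (-((J * Q * L)⁻¹ * J) *
        -(Q * (J * Q * K * S)⁻¹ / (a * b) * J) * -(Q * c / b * J) * -((J * Q * K)⁻¹ * J)) /
      (-((J * Q * K * S)⁻¹ * c / b * Q / (J * Q * L)⁻¹ * J) *
        -((J * Q * K * S)⁻¹ * c / b * Q / (S⁻¹ * a / b) * J) *
        -((J * Q * K * S)⁻¹ * c / b * Q / (R⁻¹ * c / d) * J) *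
        -((J * Q * K * S)⁻¹ * c / b * Q / (c * d) * J) *
        -((J * Q * K * S)⁻¹ * c / b * Q / (Q * c / b) * J) *
        -((J * Q * K * S)⁻¹ * c / b * (J * Q * K * Q) * J)) * Q := by
    rw [hSdef]
    field_simp
  linear_combination (t5 * t3 * t14 * t13 * t1 * t2 * t4 * t15 * t16 /
    (t18 * t17 * t7 * t12 * t11 * t10 * t9 * t8 * t6)) * key

/-! ### Non-vanishing from genericity -/

/-- The zeros of theta are powers of `p`; moving `q^i` to the other side reflects the interval `[r,
s]` to `[-s, -r]`. -/
theorem Avoids.theta_ne_zero {q p x : ℂ} {r s : ℤ} (h : Avoids q p x r s) (hp : ‖p‖ < 1)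
    (hq : q ≠ 0) (hx : x ≠ 0) {i : ℤ} (hi : -s ≤ i) (hi' : i ≤ -r) {y : ℂ} (hy : y = x * q ^ i) :
    theta y p ≠ 0 := by
  subst hy
  refine EllipticSixJ.theta_ne_zero hp (mul_ne_zero hx (zpow_ne_zero _ hq)) fun m hm => ?_
  refine h m (-i) (by omega) (by omega) ?_
  rw [← hm, mul_assoc, ← zpow_add₀ hq]
  simp

variable {q p a b c d : ℂ} {N : ℕ}

namespace Generic

theorem theta_q_ne_zero (h : Generic q p a b c d N) {i : ℕ} (hi : i < N) :
    theta (q * q ^ i) p ≠ 0 := by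
  refine theta_ne_zero_of_mul_eq_one h.p_lt (y := 1 * q ^ (-((i : ℤ) + 1)))
    ?_ (h.q_pow.theta_ne_zero h.p_lt h.q_ne one_ne_zero (by omega) (by omega) rfl)
  have := h.q_ne
  rw [zpow_neg, zpow_add_one₀ h.q_ne, zpow_natCast]
  field_simp

theorem theta_div_ne_zero (h : Generic q p a b c d N) (i : ℤ) (hi : -(N : ℤ) ≤ i) (hi' : i ≤ N)
    {y : ℂ} (hy : y = b / c * q ^ i) : theta y p ≠ 0 :=
  h.b_div_c.theta_ne_zero h.p_lt h.q_ne (div_ne_zero h.b_ne h.c_ne) (by omega) (by omega) hy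

theorem theta_div_ne_zero' (h : Generic q p a b c d N) (i : ℤ) (hi : -(N : ℤ) ≤ i) (hi' : i ≤ N)
    {y : ℂ} (hy : y = c / b * q ^ (-i)) : theta y p ≠ 0 := by
  refine theta_ne_zero_of_mul_eq_one h.p_lt ?_ (h.theta_div_ne_zero i hi hi' rfl)
  have := h.b_ne
  have := h.c_ne
  have := zpow_ne_zero i h.q_ne
  rw [hy, zpow_neg]
  field_simp

theorem theta_mul_q_pow_ne_zero (h : Generic q p a b c d N) {x : ℂ} (hx : Avoids q p x (1 - N) 0)
    (hx0 : x ≠ 0) {i : ℕ} (hi : i < N) : theta (x * q ^ i) p ≠ 0 :=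
  hx.theta_ne_zero h.p_lt h.q_ne hx0 (i := i) (by omega) (by omega) (by rw [zpow_natCast])

theorem theta_c_div_d_ne_zero (h : Generic q p a b c d N) (i : ℤ) (hi : -(N : ℤ) < i)
    (hi' : i < N) {y : ℂ} (hy : y = c / d * q ^ i) : theta y p ≠ 0 :=
  h.c_div_d.theta_ne_zero h.p_lt h.q_ne (div_ne_zero h.c_ne h.d_ne) (by omega) (by omega) hy

end Generic

/-! ### Products of binomial coefficients as terms of the series -/

/-- Here `k` and `l` are what remains after removing `j + 1` from the upper and lower index of `R`,
while `s` and `r` are their complements in `N`. This avoids truncated subtraction in the inductive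
step. -/
theorem binomCoeff_mul_step (h : Generic q p a b c d N) {j k l r s : ℕ}
    (hl : N = j + 1 + l + r) (hk : N = j + 1 + k + s) {A B C D F : ℂ}
    (hA : A = q ^ (-(N : ℤ)) * c / b) (hB : B = q ^ (-((j + 1 + l : ℕ) : ℤ)))
    (hC : C = q ^ (((j + 1 + k : ℕ) : ℤ) - N) * a / b)
    (hD : D = q ^ (((j + 1 + l : ℕ) : ℤ) - N) * c / d) (hF : F = q ^ (1 - (N : ℤ)) / (a * b))
    {P : ℂ} (hP : binomCoeff q p a c (b * q ^ s) j (k + 1) *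
      binomCoeff q p b (c * q ^ j) d (l + 1) r =
        P * V12Term q p (j + 1 + k) A B C D (c * d) F (q * c / b) j) :
    binomCoeff q p a c (b * q ^ s) (j + 1) k * binomCoeff q p b (c * q ^ (j + 1)) d l r =
      P * V12Term q p (j + 1 + k) A B C D (c * d) F (q * c / b) (j + 1) := by
  have hp := h.p_lt
  have hq := h.q_ne
  have ha := h.a_ne
  have hb := h.b_ne
  have hc := h.c_ne
  have hd := h.d_ne
  have zN : q ^ (-(N : ℤ)) = (q ^ j * q * q ^ k * q ^ s)⁻¹ := by
    rw [zpow_neg, zpow_natCast, hk]; congr 1; ring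
  have zl : q ^ (-((j + 1 + l : ℕ) : ℤ)) = (q ^ j * q * q ^ l)⁻¹ := by
    rw [zpow_neg, zpow_natCast]; congr 1; ring
  have zk : q ^ (-((j + 1 + k : ℕ) : ℤ)) = (q ^ j * q * q ^ k)⁻¹ := by
    rw [zpow_neg, zpow_natCast]; congr 1; ring
  have zkN : q ^ (((j + 1 + k : ℕ) : ℤ) - N) = (q ^ s)⁻¹ := by
    rw [← zpow_natCast, ← zpow_neg]; congr 1; omega
  have zlN : q ^ (((j + 1 + l : ℕ) : ℤ) - N) = (q ^ r)⁻¹ := by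
    rw [← zpow_natCast, ← zpow_neg]; congr 1; omega
  have z1N : q ^ (1 - (N : ℤ)) = q * (q ^ j * q * q ^ k * q ^ s)⁻¹ := by
    rw [sub_eq_add_neg, zpow_add₀ hq, zpow_one, zN]
  have hJ := pow_ne_zero j hq
  have hK := pow_ne_zero k hq
  have hL := pow_ne_zero l hq
  have hR := pow_ne_zero r hq
  have hS := pow_ne_zero s hq
  have hSR : q ^ k * q ^ s = q ^ l * q ^ r := by
    rw [← pow_add, ← pow_add]; congr 1; omega
  -- The very-well-poised factors telescope only if the intermediate ones do not vanish; their
  -- exponents `N - 2j` stay within `[-N, N]`.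
  have hAj : theta (A * q ^ (2 * j)) p ≠ 0 := by
    refine h.theta_div_ne_zero' ((N : ℤ) - 2 * j) (by omega) (by omega) ?_
    rw [hA, neg_sub, zpow_sub₀ hq, zpow_neg, zpow_mul, zpow_natCast, zpow_natCast, pow_mul]
    norm_cast
    ring
  rw [V12Term_succ _ _ _ _ _ _ _ hAj]
  have e1 := binomCoeff_succ_left (q := q) (a := a) (b := c) (c := b * q ^ s) (i := j) (j := k) hp
    hq hc (mul_ne_zero hb hS) (h.theta_q_ne_zero (by omega))
    (h.theta_mul_q_pow_ne_zero h.a_mul_c (mul_ne_zero ha hc) (by omega))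
    (h.theta_mul_q_pow_ne_zero h.a_div_c (div_ne_zero ha hc) (by omega))
    (h.theta_div_ne_zero' ((s : ℤ) + (k + 1)) (by omega) (by omega) (by
      rw [zpow_neg, zpow_add₀ hq, zpow_natCast, zpow_add_one₀ hq, zpow_natCast, pow_succ]
      field_simp))
    (h.theta_div_ne_zero' ((s : ℤ) + (k + 1) - j) (by omega) (by omega) (by
      rw [zpow_neg, zpow_sub₀ hq, zpow_add₀ hq, zpow_natCast, zpow_natCast, zpow_add_one₀ hq,
        zpow_natCast, pow_succ]
      field_simp))
    (h.theta_div_ne_zero ((s : ℤ) + k - (j + 1)) (by omega) (by omega) (by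
      rw [zpow_sub₀ hq, zpow_add₀ hq, zpow_natCast, zpow_natCast, zpow_add_one₀ hq,
        zpow_natCast, pow_succ]
      field_simp))
  have e2 := binomCoeff_shift_left (q := q) (p := p) (a := b) (b := c * q ^ j) (c := d) (i := l)
    (j := r) hq (h.theta_q_ne_zero (by omega)) (h.theta_q_ne_zero (by omega))
    (by
      rw [mul_assoc, ← pow_add]
      exact h.theta_mul_q_pow_ne_zero h.b_mul_d (mul_ne_zero hb hd) (by omega))
    (h.theta_mul_q_pow_ne_zero h.b_div_d (div_ne_zero hb hd) (by omega))
    (h.theta_c_div_d_ne_zero ((j : ℤ) - r) (by omega) (by omega) (by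
      rw [zpow_sub₀ hq, zpow_natCast, zpow_natCast]
      field_simp))
    (by
      rw [mul_right_comm]
      exact h.theta_mul_q_pow_ne_zero h.c_mul_d (mul_ne_zero hc hd) (by omega))
    (h.theta_div_ne_zero ((r : ℤ) - (j + 1)) (by omega) (by omega) (by
      rw [zpow_sub₀ hq, zpow_natCast, zpow_add_one₀ hq, zpow_natCast]
      field_simp))
  have e3 := ratio_identity hp ha hb hc hd hq hJ hK hL hR hS hSR
  have p1 : q ^ (j + 1 + k + 1) = q ^ j * q * q ^ k * q := by ring
  have p2 : q ^ (2 * (j + 1)) = (q ^ j * q) ^ 2 := by ring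
  have p3 : q ^ (2 * j) = (q ^ j) ^ 2 := by ring
  rw [show c * q ^ (j + 1) = c * q ^ j * q by ring, e1, e2, p1, p2, p3, zk]
  rw [zN] at hA
  rw [zl] at hB
  rw [zkN] at hC
  rw [zlN] at hD
  rw [z1N] at hF
  rw [← hA, ← hB, ← hC, ← hD, ← hF] at e3
  rw [pow_succ q j, pow_succ q k, pow_add q l r, ← e3, mul_mul_mul_comm, hP, mul_assoc]

/-- Apart from splitting `(b/c)_N`, the point is that `(bc)_{N-k} (bcq^{N-k})_k` and `(bc)_l
(bcq^l)_{N-l}` both equal `(bc)_N`. This trades the denominator of the first coefficient for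
`(bc)_l`. -/
theorem binomCoeff_mul_zero (h : Generic q p a b c d N) {k l : ℕ} (hk : k ≤ N) (hl : l ≤ N) :
    binomCoeff q p a c (b * q ^ (N - k)) 0 k * binomCoeff q p b (c * q ^ 0) d l (N - l) =
      prefactor q p a b c d N k l := by
  have hq := h.q_ne
  have hb := h.b_ne
  have hc := h.c_ne
  obtain ⟨s, rfl⟩ := Nat.exists_eq_add_of_le hk
  obtain ⟨r, hr⟩ := Nat.exists_eq_add_of_le hl
  have hs : k + s - k = s := by omega
  have hr' : k + s - l = r := by omega
  have z1 : q ^ ((l : ℤ) * ((l : ℤ) - (k + s : ℕ))) = (q ^ (l * r))⁻¹ := by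
    rw [hr, ← zpow_natCast, ← zpow_neg]; congr 1; push_cast; ring
  have z2 : q ^ ((l : ℤ) - (k + s : ℕ)) * c / d = c / d / q ^ r := by
    rw [show q ^ ((l : ℤ) - (k + s : ℕ)) = (q ^ r)⁻¹ by
      rw [hr, ← zpow_natCast, ← zpow_neg]; congr 1; push_cast; ring]
    ring
  have z3 : q ^ (-(l : ℤ)) * d / c = d / c / q ^ l := by
    rw [zpow_neg, zpow_natCast]; ring
  have n1 : poch q p q k ≠ 0 := poch_ne_zero fun i hi => h.theta_q_ne_zero (by omega)
  have n2 : poch q p (b / c) s ≠ 0 := poch_ne_zero fun i hi =>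
    h.theta_div_ne_zero i (by omega) (by omega) (by rw [zpow_natCast])
  have n3 : poch q p (b * c) l ≠ 0 := poch_ne_zero fun i hi =>
    h.theta_mul_q_pow_ne_zero h.b_mul_c (mul_ne_zero hb hc) (by omega)
  have n4 : poch q p (c * (b * q ^ s)) k ≠ 0 := poch_ne_zero fun i hi => by
    rw [show c * (b * q ^ s) * q ^ i = b * c * q ^ (s + i) by ring]
    exact h.theta_mul_q_pow_ne_zero h.b_mul_c (mul_ne_zero hb hc) (by omega)
  have s1 : poch q p (b / c) (k + s) = poch q p (b / c) s * poch q p (b * q ^ s / c) k := by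
    rw [add_comm, poch_add]; congr 2; ring
  have s2 : poch q p (b * c) s * poch q p (c * (b * q ^ s)) k =
      poch q p (b * c) l * poch q p (b * c * q ^ l) r := by
    rw [← poch_add, ← hr, add_comm k s, poch_add]; congr 2; ring
  have s3 : poch q p (b * c) s =
      poch q p (b * c) l * poch q p (b * c * q ^ l) r / poch q p (c * (b * q ^ s)) k := by
    rw [← s2, mul_div_cancel_right₀ _ n4]
  unfold prefactor binomCoeff
  rw [hs, hr', z1, z2, z3, s1, s3, show q ^ r * b * d = b * d * q ^ r by ring, ← hr]
  simp only [zero_mul, pow_zero, inv_one, one_mul, poch_zero, zero_add, mul_one, div_one,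
    div_self n1]
  generalize poch q p (b / c) s = x1 at *
  generalize poch q p (b * c) l = x2 at *
  have key : 1 = x1 * x2 / (x1 * x2) := by field_simp
  linear_combination (norm := skip) ((q ^ (l * r))⁻¹ * (poch q p q (k + s) /
    (poch q p q l * poch q p q r)) * (poch q p (a * c) k * poch q p (a / c) k *
      (poch q p (b * d * q ^ r) l * poch q p (b / d) l) * poch q p (b / c) r *
      poch q p (b * c * q ^ l) r / poch q p (c * (b * q ^ s)) k) /
      (poch q p (c / d / q ^ r) l * poch q p (d / c / q ^ l) r * poch q p (c * d) (k + s) *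
        poch q p (b * q ^ s / c) k)) * key
  ring

theorem Generic.theta_A_ne_zero (h : Generic q p a b c d N) :
    theta (q ^ (-(N : ℤ)) * c / b) p ≠ 0 :=
  h.theta_div_ne_zero' N (by omega) le_rfl (by ring)

theorem binomCoeff_mul_eq (h : Generic q p a b c d N) {j k l : ℕ} (hk : k ≤ N) (hl : l ≤ N)
    (hjk : j ≤ k) (hjl : j ≤ l) :
    binomCoeff q p a c (b * q ^ (N - k)) j (k - j) *
        binomCoeff q p b (c * q ^ j) d (l - j) (N - l) =
      prefactor q p a b c d N k l *
        V12Term q p k (q ^ (-(N : ℤ)) * c / b) (q ^ (-(l : ℤ))) (q ^ ((k : ℤ) - N) * a / b)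
          (q ^ ((l : ℤ) - N) * c / d) (c * d) (q ^ (1 - (N : ℤ)) / (a * b)) (q * c / b) j := by
  induction j with
  | zero =>
    rw [V12Term_zero _ _ _ _ _ _ _ h.theta_A_ne_zero, mul_one]
    exact binomCoeff_mul_zero h hk hl
  | succ j ih =>
    have := ih (by omega) (by omega)
    obtain ⟨k, rfl⟩ := Nat.exists_eq_add_of_le hjk
    obtain ⟨l, rfl⟩ := Nat.exists_eq_add_of_le hjl
    rw [show j + 1 + k - (j + 1) = k by omega, show j + 1 + l - (j + 1) = l by omega]
    rw [show j + 1 + k - j = k + 1 by omega, show j + 1 + l - j = l + 1 by omega] at this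
    exact binomCoeff_mul_step h (by omega) (by omega) rfl rfl rfl rfl rfl this

/-- The parameter `q^{-l}` contributes the factor `θ(1) = 0` as soon as `j > l`. -/
theorem V12Term_eq_zero (hq : q ≠ 0) {j l : ℕ} (hjl : l < j) (n : ℕ) (A C D E F G : ℂ) :
    V12Term q p n A (q ^ (-(l : ℤ))) C D E F G j = 0 := by
  have : poch q p (q ^ (-(l : ℤ))) j = 0 :=
    poch_eq_zero hjl (by rw [zpow_neg, zpow_natCast, inv_mul_cancel₀ (pow_ne_zero _ hq)])
  simp only [V12Term, this, mul_zero, zero_mul, zero_div]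

theorem Generic.binomGeneric_left (h : Generic q p a b c d N) {k : ℕ} (hk : k ≤ N) :
    BinomGeneric q p c (b * q ^ (N - k)) k where
  p_lt := h.p_lt
  q_ne := h.q_ne
  b_ne := h.c_ne
  c_ne := mul_ne_zero h.b_ne (pow_ne_zero _ h.q_ne)
  theta_q i hi := h.theta_q_ne_zero (by omega)
  theta_mul i hi := by
    rw [show c * (b * q ^ (N - k)) * q ^ i = b * c * q ^ (N - k + i) by ring]
    exact h.theta_mul_q_pow_ne_zero h.b_mul_c (mul_ne_zero h.b_ne h.c_ne) (by omega)
  theta_div i j hi hj := by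
    refine h.theta_div_ne_zero' (((N - k : ℕ) : ℤ) + j - i) (by omega) (by omega) ?_
    have hq := h.q_ne
    have hb := h.b_ne
    rw [zpow_neg, zpow_sub₀ hq, zpow_add₀ hq, zpow_natCast, zpow_natCast, zpow_natCast]
    field_simp

theorem Generic.binomGeneric_right (h : Generic q p a b c d N) (j : ℕ) :
    BinomGeneric q p (c * q ^ j) d (N - j) where
  p_lt := h.p_lt
  q_ne := h.q_ne
  b_ne := mul_ne_zero h.c_ne (pow_ne_zero _ h.q_ne)
  c_ne := h.d_ne
  theta_q i hi := h.theta_q_ne_zero (by omega)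
  theta_mul i hi := by
    rw [show c * q ^ j * d * q ^ i = c * d * q ^ (j + i) by ring]
    exact h.theta_mul_q_pow_ne_zero h.c_mul_d (mul_ne_zero h.c_ne h.d_ne) (by omega)
  theta_div i i' hi hi' := by
    refine h.theta_c_div_d_ne_zero ((j : ℤ) + i - i') (by omega) (by omega) ?_
    have hq := h.q_ne
    have hd := h.d_ne
    rw [zpow_sub₀ hq, zpow_add₀ hq, zpow_natCast, zpow_natCast, zpow_natCast]
    field_simp

/-! ### Existence of the expansion -/

/-- The coefficients `R_k^l`. -/
def sixJ (q p a b c d : ℂ) (N k l : ℕ) : ℂ :=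
  prefactor q p a b c d N k l *
    V12 q p k (q ^ (-(N : ℤ)) * c / b) (q ^ (-(l : ℤ))) (q ^ ((k : ℤ) - N) * a / b)
      (q ^ ((l : ℤ) - N) * c / d) (c * d) (q ^ (1 - (N : ℤ)) / (a * b)) (q * c / b)

theorem sixJ_eq_sum (h : Generic q p a b c d N) {k l : ℕ} (hk : k ≤ N) (hl : l ≤ N) :
    sixJ q p a b c d N k l = ∑ j ∈ Finset.range (k + 1),
      -- The guard is needed because `l - j` truncates to `0` for `j > l`; the series term vanishes
      -- there.
      if j ≤ l then binomCoeff q p a c (b * q ^ (N - k)) j (k - j) *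
        binomCoeff q p b (c * q ^ j) d (l - j) (N - l) else 0 := by
  rw [sixJ, V12_eq_sum, Finset.mul_sum]
  refine Finset.sum_congr rfl fun j hj => ?_
  rw [Finset.mem_range] at hj
  split_ifs with hjl
  · exact (binomCoeff_mul_eq h hk hl (by omega) hjl).symm
  · rw [V12Term_eq_zero h.q_ne (by omega), mul_zero]

theorem hXi_mul_hXi_eq_sum (h : Generic q p a b c d N) {k : ℕ} (hk : k ≤ N) {ξ : ℂ} (hξ : ξ ≠ 0) :
    hXi q p k ξ a * hXi q p (N - k) ξ b = ∑ l ∈ Finset.range (N + 1),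
      sixJ q p a b c d N k l * (hXi q p l ξ c * hXi q p (N - l) ξ d) := by
  rw [hXi_eq_sum_antidiagonal (h.binomGeneric_left hk) h.a_ne hξ,
    Finset.Nat.sum_antidiagonal_eq_sum_range_succ (fun i j =>
      binomCoeff q p a c (b * q ^ (N - k)) i j * (hXi q p i ξ c * hXi q p j ξ (b * q ^ (N - k)))),
    Finset.sum_mul]
  have h1 : ∀ l ∈ Finset.range (N + 1),
      sixJ q p a b c d N k l * (hXi q p l ξ c * hXi q p (N - l) ξ d) =
      ∑ j ∈ Finset.range (k + 1), (if j ≤ l then binomCoeff q p a c (b * q ^ (N - k)) j (k - j) *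
        binomCoeff q p b (c * q ^ j) d (l - j) (N - l) else 0) *
          (hXi q p l ξ c * hXi q p (N - l) ξ d) := fun l hl => by
    rw [Finset.mem_range] at hl
    rw [sixJ_eq_sum h hk (by omega), Finset.sum_mul]
  -- With the sum over `j` outermost, each `j` needs just one application of the binomial theorem to
  -- `h_{N-j}(x;b)`.
  rw [Finset.sum_congr rfl h1, Finset.sum_comm]
  refine Finset.sum_congr rfl fun j hj => ?_
  rw [Finset.mem_range] at hj
  have h2 : hXi q p (k - j) ξ (b * q ^ (N - k)) * hXi q p (N - k) ξ b = hXi q p (N - j) ξ b := by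
    rw [mul_comm, ← hXi_add]; congr 1; omega
  rw [mul_assoc, mul_assoc, h2, hXi_eq_sum_antidiagonal (h.binomGeneric_right j) h.b_ne hξ,
    Finset.Nat.sum_antidiagonal_eq_sum_range_succ (fun i i' =>
      binomCoeff q p b (c * q ^ j) d i i' * (hXi q p i ξ (c * q ^ j) * hXi q p i' ξ d)),
    -- The terms with `l < j` are zero by the guard; the rest are indexed by `l = j + i`.
    show N + 1 = j + (N - j + 1) by omega, Finset.sum_range_add, Finset.mul_sum, Finset.mul_sum,
    Finset.sum_eq_zero (s := Finset.range j), zero_add]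
  · refine Finset.sum_congr rfl fun i hi => ?_
    rw [if_pos (Nat.le_add_right j i), hXi_add q p j i, Nat.add_sub_cancel_left,
      show N - (j + i) = N - j - i by omega]
    ring
  · intro i hi
    rw [Finset.mem_range] at hi
    rw [if_neg (by omega), zero_mul]

/-! ### Uniqueness of the coefficients -/

theorem continuousAt_poch (hp : ‖p‖ < 1) (hq : q ≠ 0) {x : ℂ} (hx : x ≠ 0) (k : ℕ) :
    ContinuousAt (fun y => poch q p y k) x := by
  unfold poch
  refine tendsto_finsetProd _ fun j _ => ?_
  have h1 : ContinuousAt (fun y => theta y p) (x * q ^ j) :=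
    continuousAt_theta hp (mul_ne_zero hx (pow_ne_zero j hq))
  exact h1.comp (f := fun y => y * q ^ j) (by fun_prop)

theorem continuousAt_hXi (hp : ‖p‖ < 1) (hq : q ≠ 0) {u ξ : ℂ} (hu : u ≠ 0) (hξ : ξ ≠ 0) (k : ℕ) :
    ContinuousAt (fun η => hXi q p k η u) ξ := by
  have h1 := continuousAt_poch hp hq (mul_ne_zero hu hξ) k
  have h2 := continuousAt_poch hp hq (mul_ne_zero hu (inv_ne_zero hξ)) k
  exact (h1.comp (f := fun y => u * y) (by fun_prop)).mul
    (h2.comp (f := fun y => u * y⁻¹) (continuousAt_const.mul (continuousAt_inv₀ hξ)))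

/-- Off this set `h_1` can be cancelled, and the complement of a countable set is dense in the
plane. -/
theorem countable_hXi_zeros (hp : ‖p‖ < 1) {u : ℂ} (hu : u ≠ 0) :
    {ξ : ℂ | ξ = 0 ∨ hXi q p 1 ξ u = 0}.Countable := by
  have h1 := (countable_theta_zeros hp).preimage (mul_right_injective₀ hu)
  have h2 := (countable_theta_zeros hp).preimage ((mul_right_injective₀ hu).comp inv_injective)
  refine (((Set.countable_singleton (0 : ℂ)).union h1).union h2).mono fun ξ hξ => ?_
  by_cases h0 : ξ = 0
  · exact Or.inl (Or.inl h0)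
  have hξ' : hXi q p 1 ξ u = 0 := hξ.resolve_left h0
  rw [hXi, poch_one, poch_one] at hξ'
  rcases mul_eq_zero.mp hξ' with h | h
  · exact Or.inl (Or.inr ⟨mul_ne_zero hu h0, h⟩)
  · exact Or.inr ⟨mul_ne_zero hu (inv_ne_zero h0), h⟩

theorem BinomGeneric.shift {n : ℕ} (h : BinomGeneric q p c d (n + 1)) :
    BinomGeneric q p (c * q) d n where
  p_lt := h.p_lt
  q_ne := h.q_ne
  b_ne := mul_ne_zero h.b_ne h.q_ne
  c_ne := h.c_ne
  theta_q i hi := h.theta_q i (by omega)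
  theta_mul i hi := by
    rw [show c * q * d * q ^ i = c * d * q ^ (i + 1) by ring]
    exact h.theta_mul _ (by omega)
  theta_div i j hi hj := by
    rw [show c * q / d * q ^ i = c / d * q ^ (i + 1) by ring]
    exact h.theta_div _ _ (by omega) (by omega)

/-- Linear independence of the products `h_l(x;c)h_{n-l}(x;d)`. -/
theorem eq_zero_of_sum_hXi_eq_zero {n : ℕ} (h : BinomGeneric q p c d n) {R : ℕ → ℂ}
    (hR : ∀ ξ : ℂ, ξ ≠ 0 →
      ∑ l ∈ Finset.range (n + 1), R l * (hXi q p l ξ c * hXi q p (n - l) ξ d) = 0) :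
    ∀ l ≤ n, R l = 0 := by
  induction n generalizing c R with
  | zero =>
    intro l hl
    obtain rfl : l = 0 := by omega
    simpa [hXi_zero] using hR 1 one_ne_zero
  | succ n ih =>
    have hp := h.p_lt
    have hq := h.q_ne
    have hc := h.b_ne
    have hd := h.c_ne
    have h0 : R 0 = 0 := by
      -- At `ξ = c` every `h_l(x;c)` with `l ≥ 1` contains `θ(c/c) = 0`, while `h_{n+1}(x;d)` is
      -- non-zero by genericity.
      have h1 := hR c hc
      rw [Finset.sum_range_succ', Finset.sum_eq_zero, zero_add, hXi_zero, one_mul] at h1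
      · refine (mul_eq_zero.mp h1).resolve_right (mul_ne_zero ?_ ?_)
        · refine poch_ne_zero fun i hi => ?_
          rw [mul_comm d c]
          exact h.theta_mul i (by omega)
        · refine poch_ne_zero fun i hi => ?_
          have := h.theta_div' i 0 (by omega) (by omega)
          rwa [pow_zero, div_one, div_eq_mul_inv] at this
      · intro l _
        rw [hXi, poch_eq_zero (Nat.succ_pos l) (x := c * c⁻¹) (by simp [hc])]
        simp
    -- Since `h_{l+1}(x;c) = h_1(x;c) h_l(x;cq)`, the remaining sum is `h_1(x;c)` times one of the
    -- same kind with `cq` for `c`.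
    have hsum : ∀ ξ : ℂ, hXi q p 1 ξ c * ∑ l ∈ Finset.range (n + 1),
        R (l + 1) * (hXi q p l ξ (c * q) * hXi q p (n - l) ξ d) =
        ∑ l ∈ Finset.range (n + 1 + 1), R l * (hXi q p l ξ c * hXi q p (n + 1 - l) ξ d) := by
      intro ξ
      rw [Finset.sum_range_succ' _ (n + 1), h0, zero_mul, add_zero, Finset.mul_sum]
      refine Finset.sum_congr rfl fun l _ => ?_
      rw [add_comm l 1, hXi_add q p 1 l, pow_one, Nat.add_comm n 1, Nat.add_sub_add_left]
      ring
    have key : ∀ ξ : ℂ, ξ ≠ 0 → ∑ l ∈ Finset.range (n + 1),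
        R (l + 1) * (hXi q p l ξ (c * q) * hXi q p (n - l) ξ d) = 0 := by
      intro ξ hξ
      -- Cancelling `h_1` gives the vanishing on a dense set only; continuity extends it to the
      -- given `ξ`.
      have hdense := (countable_hXi_zeros (q := q) hp hc).dense_compl ℝ
      have hcont : ContinuousAt (fun η => ∑ l ∈ Finset.range (n + 1),
          R (l + 1) * (hXi q p l η (c * q) * hXi q p (n - l) η d)) ξ :=
        tendsto_finsetSum _ fun l _ => continuousAt_const.mul
          ((continuousAt_hXi hp hq (mul_ne_zero hc hq) hξ l).mul
            (continuousAt_hXi hp hq hd hξ (n - l)))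
      have hne := mem_closure_iff_nhdsWithin_neBot.mp (hdense ξ)
      refine @tendsto_nhds_unique _ _ _ _ _ _ _ _ hne
        (hcont.tendsto.mono_left nhdsWithin_le_nhds) ?_
      refine tendsto_const_nhds.congr' ?_
      filter_upwards [self_mem_nhdsWithin] with η hη
      simp only [Set.mem_compl_iff, Set.mem_ofPred_eq, not_or] at hη
      exact ((mul_eq_zero.mp ((hsum η).trans (hR η hη.1))).resolve_left hη.2).symm
    intro l hl
    rcases l with _ | l
    · exact h0
    · exact ih h.shift key l (by omega)

/-! ### Return to the variable `x` and conclusion -/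

theorem h_eq_hXi (q p : ℂ) (k : ℕ) (u : ℂ) {ξ : ℂ} (hξ : ξ ≠ 0) :
    h q p k (ξ + ξ⁻¹) u = hXi q p k ξ u := h_add_inv q p k u ξ hξ

theorem isExpansion_sixJ (h : Generic q p a b c d N) {k : ℕ} (hk : k ≤ N) :
    IsExpansion q p a b c d N k fun l => sixJ q p a b c d N k l := by
  intro x
  obtain ⟨ξ, hξ, rfl⟩ := exists_xi x
  simp only [h_eq_hXi q p _ _ hξ]
  rw [hXi_mul_hXi_eq_sum h hk hξ, Finset.sum_range]

theorem IsExpansion.unique (h : Generic q p a b c d N) {k : ℕ} {R R' : Fin (N + 1) → ℂ}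
    (hR : IsExpansion q p a b c d N k R) (hR' : IsExpansion q p a b c d N k R') : R = R' := by
  have h1 : BinomGeneric q p c d N := by simpa using h.binomGeneric_right 0
  -- Linear independence is stated for sequences on `ℕ`, so the difference of the two families is
  -- extended by zero.
  have h2 := eq_zero_of_sum_hXi_eq_zero h1
    (R := fun l => if hl : l < N + 1 then R ⟨l, hl⟩ - R' ⟨l, hl⟩ else 0) fun ξ hξ => by
      have e := (hR (ξ + ξ⁻¹)).symm.trans (hR' (ξ + ξ⁻¹))
      simp only [h_eq_hXi q p _ _ hξ] at e
      rw [Finset.sum_range]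
      simp only [Fin.is_lt, dite_true, Fin.eta, sub_mul, Finset.sum_sub_distrib, e, sub_self]
  ext l
  have h3 := h2 l (by omega)
  simp only [Fin.is_lt, dite_true, Fin.eta] at h3
  exact sub_eq_zero.mp h3

theorem Generic.isBalanced (h : Generic q p a b c d N) (k l : ℕ) :
    IsBalanced q k (q ^ (-(N : ℤ)) * c / b) (q ^ (-(l : ℤ)))
      (q ^ ((k : ℤ) - N) * a / b) (q ^ ((l : ℤ) - N) * c / d) (c * d)
      (q ^ (1 - (N : ℤ)) / (a * b)) (q * c / b) := by
  have hq := h.q_ne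
  have ha := h.a_ne
  have hb := h.b_ne
  have hd := h.d_ne
  unfold IsBalanced
  simp only [zpow_sub₀ hq, zpow_neg, zpow_one, zpow_natCast]
  field_simp
  ring

end EllipticSixJ

end

theorem mainTheorem2 (q p a b c d : ℂ) (N : ℕ)
    (hgen : EllipticSixJ.Generic q p a b c d N) (k : ℕ) (hk : k ≤ N) :
    (∃! R : Fin (N + 1) → ℂ, EllipticSixJ.IsExpansion q p a b c d N k R) ∧
    ∀ R : Fin (N + 1) → ℂ, EllipticSixJ.IsExpansion q p a b c d N k R →
      ∀ l : Fin (N + 1),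
        EllipticSixJ.IsBalanced q k (q ^ (-(N : ℤ)) * c / b) (q ^ (-((l : ℕ) : ℤ)))
          (q ^ ((k : ℤ) - N) * a / b) (q ^ (((l : ℕ) : ℤ) - N) * c / d) (c * d)
          (q ^ (1 - (N : ℤ)) / (a * b)) (q * c / b) ∧
        R l = EllipticSixJ.prefactor q p a b c d N k l *
          EllipticSixJ.V12 q p k (q ^ (-(N : ℤ)) * c / b) (q ^ (-((l : ℕ) : ℤ)))
            (q ^ ((k : ℤ) - N) * a / b) (q ^ (((l : ℕ) : ℤ) - N) * c / d) (c * d)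
            (q ^ (1 - (N : ℤ)) / (a * b)) (q * c / b) := by
  have hex := EllipticSixJ.isExpansion_sixJ hgen hk
  refine ⟨⟨_, hex, fun R hR => hR.unique hgen hex⟩, fun R hR l => ⟨hgen.isBalanced k l, ?_⟩⟩
  rw [hR.unique hgen hex]
  rfl
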